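/- Let $E,A\in\mathbb R^{n\times n}$, $B\in\mathbb R^{n\times m}$, $C\in\mathbb R^{m\times n}$, $D\in\mathbb R^{m\times m}$ be the matrices of the descriptor system $E\dot x=Ax+Bu$, $y=Cx+Du$ (with as many outputs as inputs). Assume that the pencil $\lambda E-A$ is regular, i.e. $\det(\lambda E-A)\neq0$ for some $\lambda\in\mathbb C$, and that the system is R-controllable and R-observable, i.e. $\operatorname{rank}[\lambda E-A,\ B]=n$ and $\operatorname{rank}\begin{bmatrix}\lambda E-A\\ C\end{bmatrix}=n$ for all $\lambda\in\mathbb C$. Let $\varsigma>0$ and let $G(s)=C(sE-A)^{-1}B+D$ be the transfer function. By the Weierstrass form there are invertible matrices $W,T$ with $$W(\lambda E-A)T=\lambda\begin{bmatrix}I&0\\0&N\end{bmatrix}-\begin{bmatrix}J&0\\0&I\end{bmatrix},\qquad N\text{ nilpotent};$$ let $P_\ell=W^{-1}\begin{bmatrix}I&0\\0&0\end{bmatrix}W$ and $P_r=T\begin{bmatrix}I&0\\0&0\end{bmatrix}T^{-1}$ be the spectral projectors onto the left and right deflating subspaces of the finite eigenvalues (they are real and do not depend on the choice of $W,T$). Write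 $G=G_{sp}+P$ with $G_{sp}$ strictly proper rational and $P(s)=\sum_{k\ge0}M_ks^k$ polynomial. Then $G(s)G^T(-s)=\varsigma^2I_m$ (for all $s\in\mathbb C$ such that neither $s$ nor $-s$ is a finite eigenvalue of $\lambda E-A$) if and only if there are matrices $\mathcal G_{pc},\mathcal G_{po}\in\mathbb R^{n\times n}$ such that all of the following hold: 1. $\mathcal G_{pc}$ and $\mathcal G_{po}$ are symmetric, $\mathcal G_{pc}=P_r\mathcal G_{pc}P_r^T$ and $\mathcal G_{po}=P_\ell^T\mathcal G_{po}P_\ell$; 2. $E\mathcal G_{pc}A^T+A\mathcal G_{pc}E^T+P_\ell BB^TP_\ell^T=0$ and $E^T\mathcal G_{po}A+A^T\mathcal G_{po}E+P_r^TC^TCP_r=0$; 3. $\mathcal G_{pc}E^T\mathcal G_{po}E=\varsigma^2P_r$ and $\mathcal G_{po}E\mathcal G_{pc}E^T=\varsigma^2P_\ell^T$; 4. $M_0M_0^T=\varsigma^2I_m$ and $M_k=0$ for all $k\ge1$; 5. $M_0^TCP_r+B^T\mathcal G_{po}E=0$ and $M_0B^TP_\ell^T+C\mathcal G_{pc}E^T=0$.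 -/

import Mathlib

open Matrix Polynomial

/-- A linear time-invariant descriptor system `E x' = A x + B u`, `y = C x + D u`
with real coefficient matrices. -/
structure DescriptorSystem (n m p : ℕ) where
  E : Matrix (Fin n) (Fin n) ℝ
  A : Matrix (Fin n) (Fin n) ℝ
  B : Matrix (Fin n) (Fin m) ℝ
  C : Matrix (Fin p) (Fin n) ℝ
  D : Matrix (Fin p) (Fin m) ℝ

/-- The matrix `z E - A`, for `z` in a field extension `K` of `ℝ`. It is used for complex numbers
`z` and for the indeterminate of the field of rational functions. -/
def matrixPencil {n : ℕ} {K : Type*} [Field K] [Algebra ℝ K]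
    (E A : Matrix (Fin n) (Fin n) ℝ) (z : K) : Matrix (Fin n) (Fin n) K :=
  z • E.map (algebraMap ℝ K) - A.map (algebraMap ℝ K)

/-- The pencil `λ E - A` is regular: `det (λ E - A) ≠ 0` for at least one complex `λ`. -/
def IsRegularPencil {n : ℕ} (E A : Matrix (Fin n) (Fin n) ℝ) : Prop :=
  ∃ z : ℂ, (matrixPencil E A z).det ≠ 0

/-- A (block) Weierstrass form of the pencil `λ E - A` over a field `K`: invertible `W`, `T` with
`W (λ E - A) T = λ diag (1, N) - diag (J, 1)` and `N` nilpotent. The bijection `ι` only orders the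
block indices. A further reduction of `J` and `N` to Jordan form is not demanded: it does not
change the spectral projectors, see
`WeierstrassForm.projectors_unique` and `WeierstrassForm.projectors_map`. -/
structure WeierstrassForm {K : Type*} [Field K] {n : ℕ} (E A : Matrix (Fin n) (Fin n) K) where
  nf : ℕ
  ni : ℕ
  ι : Fin nf ⊕ Fin ni ≃ Fin n
  W : Matrix (Fin n) (Fin n) K
  T : Matrix (Fin n) (Fin n) K
  isUnit_W : IsUnit W
  isUnit_T : IsUnit T
  J : Matrix (Fin nf) (Fin nf) K
  N : Matrix (Fin ni) (Fin ni) K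
  isNilpotent_N : IsNilpotent N
  E_eq : W * E * T = reindex ι ι (fromBlocks 1 0 0 N)
  A_eq : W * A * T = reindex ι ι (fromBlocks J 0 0 1)

namespace WeierstrassForm

variable {K : Type*} [Field K] {n : ℕ} {E A : Matrix (Fin n) (Fin n) K}

/-- The projector onto the left deflating subspace of the finite eigenvalues. -/
noncomputable def left (F : WeierstrassForm E A) : Matrix (Fin n) (Fin n) K :=
  F.W⁻¹ * reindex F.ι F.ι (fromBlocks 1 0 0 0) * F.W

/-- The projector onto the right deflating subspace of the finite eigenvalues. -/
noncomputable def right (F : WeierstrassForm E A) : Matrix (Fin n) (Fin n) K :=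
  F.T * reindex F.ι F.ι (fromBlocks 1 0 0 0) * F.T⁻¹

end WeierstrassForm

theorem fromBlocks_zero_zero_pow {K : Type*} [Field K] {a b : ℕ} (X : Matrix (Fin a) (Fin a) K)
    (Y : Matrix (Fin b) (Fin b) K) (j : ℕ) :
    fromBlocks X 0 0 Y ^ j = fromBlocks (X ^ j) 0 0 (Y ^ j) := by
  induction j with
  | zero => simp
  | succ j ih => rw [pow_succ, ih, fromBlocks_multiply]; simp [pow_succ]

/-- Fitting decomposition of a square matrix. -/
theorem exists_fitting_form {K : Type*} [Field K] {n : ℕ} (M : Matrix (Fin n) (Fin n) K) :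
    ∃ (nf ni : ℕ) (ι : Fin nf ⊕ Fin ni ≃ Fin n) (T : Matrix (Fin n) (Fin n) K)
      (M₁ : Matrix (Fin nf) (Fin nf) K) (M₂ : Matrix (Fin ni) (Fin ni) K),
      IsUnit T ∧ IsUnit M₁ ∧ IsNilpotent M₂ ∧
        T⁻¹ * M * T = reindex ι ι (fromBlocks M₁ 0 0 M₂) := by
  classical
  set f : Module.End K (Fin n → K) := Matrix.toLin' M with hf
  obtain ⟨k₀, hk₀⟩ := Filter.eventually_atTop.mp f.eventually_isCompl_ker_pow_range_pow
  set k := k₀ + 1 with hk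
  have hc : IsCompl (LinearMap.range (f ^ k)) (LinearMap.ker (f ^ k)) := (hk₀ k (by omega)).symm
  let bR := Module.finBasis K (LinearMap.range (f ^ k))
  let bN := Module.finBasis K (LinearMap.ker (f ^ k))
  let b := (bR.prod bN).map (Submodule.prodEquivOfIsCompl _ _ hc)
  let ι := b.indexEquiv (Pi.basisFun K (Fin n))
  let c := b.reindex ι
  have hbl : ∀ i, b (Sum.inl i) = (bR i : Fin n → K) := fun i => by simp [b]
  have hbr : ∀ i, b (Sum.inr i) = (bN i : Fin n → K) := fun i => by simp [b]
  set L := LinearMap.toMatrix b b f with hL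
  have hrl : ∀ x : LinearMap.range (f ^ k), ∀ i, b.repr (x : Fin n → K) (Sum.inr i) = 0 := by
    intro x i
    have : (Submodule.prodEquivOfIsCompl _ _ hc).symm (x : Fin n → K) = (x, 0) :=
      Submodule.prodEquivOfIsCompl_symm_apply_left _ _ hc x
    simp [b, this]
  have hrr : ∀ x : LinearMap.ker (f ^ k), ∀ i, b.repr (x : Fin n → K) (Sum.inl i) = 0 := by
    intro x i
    have : (Submodule.prodEquivOfIsCompl _ _ hc).symm (x : Fin n → K) = (0, x) :=
      Submodule.prodEquivOfIsCompl_symm_apply_right _ _ hc x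
    simp [b, this]
  have hcomm : ∀ x, (f ^ k) (f x) = f ((f ^ k) x) := fun x => by
    rw [← Module.End.mul_apply, ← Module.End.mul_apply, ← pow_succ, ← pow_succ']
  have h21 : L.toBlocks₂₁ = 0 := by
    ext i j
    obtain ⟨y, hy⟩ := (bR j).2
    have := hrl ⟨f (bR j), ⟨f y, by rw [hcomm, hy]⟩⟩ i
    simpa [L, toBlocks₂₁, LinearMap.toMatrix_apply, hbl] using this
  have h12 : L.toBlocks₁₂ = 0 := by
    ext i j
    have hy : (f ^ k) (bN j : Fin n → K) = 0 := (bN j).2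
    have := hrr ⟨f (bN j), by rw [LinearMap.mem_ker, hcomm, hy, map_zero]⟩ i
    simpa [L, toBlocks₁₂, LinearMap.toMatrix_apply, hbr] using this
  have hLb : L = fromBlocks L.toBlocks₁₁ 0 0 L.toBlocks₂₂ := by
    conv_lhs => rw [← fromBlocks_toBlocks L, h21, h12]
  have hpow : ∀ j : ℕ, L ^ j = fromBlocks (L.toBlocks₁₁ ^ j) 0 0 (L.toBlocks₂₂ ^ j) := by
    intro j
    conv_lhs => rw [hLb]
    exact fromBlocks_zero_zero_pow _ _ j
  have hLk : L ^ k = LinearMap.toMatrix b b (f ^ k) := by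
    rw [hL, LinearMap.toMatrix_pow]
  refine ⟨_, _, ι, (Pi.basisFun K (Fin n)).toMatrix c, L.toBlocks₁₁, L.toBlocks₂₂,
    ?_, ?_, ⟨k, ?_⟩, ?_⟩
  · have := (Pi.basisFun K (Fin n)).invertibleToMatrix c
    exact isUnit_of_invertible _
  · rw [← Matrix.mulVec_injective_iff_isUnit]
    intro v w hvw
    have hv : L.toBlocks₁₁ *ᵥ (v - w) = 0 := by
      rw [Matrix.mulVec_sub]; exact sub_eq_zero.mpr hvw
    set u := v - w
    let x : Fin n → K := b.equivFun.symm (Sum.elim u 0)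
    have hx : x = ((∑ i, u i • bR i : LinearMap.range (f ^ k)) : Fin n → K) := by
      simp [x, Module.Basis.equivFun_symm_apply, hbl]
    have hfx : f x = 0 := by
      have h1 : L *ᵥ (Sum.elim u 0) = 0 := by
        rw [hLb, fromBlocks_mulVec]
        ext i; cases i <;> simp [hv]
      have h2 : L *ᵥ (b.repr x) = b.repr (f x) := LinearMap.toMatrix_mulVec_repr b b f x
      have h3 : (b.repr x : _ → K) = Sum.elim u 0 := by
        have := b.equivFun.apply_symm_apply (Sum.elim u 0)
        rw [← this]; rfl
      rw [h3, h1] at h2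
      apply b.repr.injective
      ext i
      simp [← congrFun h2 i]
    have hxk : x ∈ LinearMap.ker (f ^ k) := by
      rw [LinearMap.mem_ker, hk, pow_succ, Module.End.mul_apply, hfx, map_zero]
    have hx0 : x = 0 := by
      have hxr : x ∈ LinearMap.range (f ^ k) := by rw [hx]; exact Subtype.prop _
      exact (Submodule.disjoint_def.mp hc.disjoint) x hxr hxk
    have hu : u = 0 := by
      have h0 : b.equivFun x = Sum.elim u 0 := b.equivFun.apply_symm_apply (Sum.elim u 0)
      rw [hx0, map_zero] at h0
      ext i; simpa using (congrFun h0 (Sum.inl i)).symm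
    exact sub_eq_zero.mp hu
  · have h := hpow k
    ext i j
    have h' : (L ^ k) (Sum.inr i) (Sum.inr j) = (L.toBlocks₂₂ ^ k) i j := by rw [h]; rfl
    rw [← h', hLk, LinearMap.toMatrix_apply, hbr]
    have hy : (f ^ k) (bN j : Fin n → K) = 0 := (bN j).2
    simp [hy]
  · have hT : ((Pi.basisFun K (Fin n)).toMatrix c)⁻¹ = c.toMatrix (Pi.basisFun K (Fin n)) :=
      Matrix.inv_eq_left_inv (Module.Basis.toMatrix_mul_toMatrix_flip _ _)
    have hM : M = LinearMap.toMatrix (Pi.basisFun K (Fin n)) (Pi.basisFun K (Fin n)) f := by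
      rw [hf, LinearMap.toMatrix_eq_toMatrix', LinearMap.toMatrix'_toLin']
    rw [hT, ← hLb]
    conv_lhs => rw [hM]
    rw [basis_toMatrix_mul_linearMap_toMatrix_mul_basis_toMatrix]
    ext i j
    simp [c, L, LinearMap.toMatrix_apply]

/-- A regular real pencil has a Weierstrass form. -/
theorem IsRegularPencil.exists_weierstrassForm {n : ℕ} {E A : Matrix (Fin n) (Fin n) ℝ}
    (h : IsRegularPencil E A) : Nonempty (WeierstrassForm E A) := by
  classical
  let Q : ℝ[X] := ((X : ℝ[X]) • E.map (C : ℝ →+* ℝ[X]) - A.map (C : ℝ →+* ℝ[X])).det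
  have hev : ∀ {R : Type} [Field R] [Algebra ℝ R] (z : R),
      aeval z Q = (matrixPencil E A z).det := by
    intro R _ _ z
    rw [AlgHom.map_det]
    congr 1
    ext i j
    simp [matrixPencil, mul_comm z]
  have hQ : Q ≠ 0 := by
    obtain ⟨z, hz⟩ := h
    rintro h0
    exact hz (by rw [← hev z, h0, map_zero])
  obtain ⟨μ, hμ⟩ : ∃ μ : ℝ, Q.eval μ ≠ 0 := by
    by_contra! hall
    exact hQ (Polynomial.funext (by simpa using hall))
  have hdet : (μ • E - A).det ≠ 0 := by
    have := hev (R := ℝ) μ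
    rw [coe_aeval_eq_eval] at this
    rw [this] at hμ
    simpa [matrixPencil] using hμ
  set M := μ • E - A with hM
  have hMu : IsUnit M := (Matrix.isUnit_iff_isUnit_det _).mpr (isUnit_iff_ne_zero.mpr hdet)
  have hMd : IsUnit M.det := (Matrix.isUnit_iff_isUnit_det _).mp hMu
  obtain ⟨nf, ni, ι, T, K₁, K₂, hT, hK₁, hK₂, hfit⟩ := exists_fitting_form (M⁻¹ * E)
  have hTd : IsUnit T.det := (Matrix.isUnit_iff_isUnit_det _).mp hT
  have hL : IsUnit (μ • K₂ - 1) := by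
    have : IsNilpotent (μ • K₂) := by
      obtain ⟨k, hk⟩ := hK₂
      exact ⟨k, by rw [_root_.smul_pow, hk, smul_zero]⟩
    exact this.isUnit_sub_one
  set L := μ • K₂ - 1 with hLdef
  have hLd : IsUnit L.det := (Matrix.isUnit_iff_isUnit_det _).mp hL
  have hK₁d : IsUnit K₁.det := (Matrix.isUnit_iff_isUnit_det _).mp hK₁
  have hA : T⁻¹ * (M⁻¹ * A) * T = reindex ι ι (fromBlocks (μ • K₁ - 1) 0 0 L) := by
    have h1 : M⁻¹ * A = μ • (M⁻¹ * E) - 1 := by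
      have : A = μ • E - M := by rw [hM]; abel
      conv_lhs => rw [this]
      rw [mul_sub, Matrix.nonsing_inv_mul _ hMd, Matrix.mul_smul]
    rw [h1, mul_sub, sub_mul, Matrix.mul_smul, Matrix.smul_mul, hfit, mul_one,
      Matrix.nonsing_inv_mul _ hTd]
    ext i j
    obtain ⟨i, rfl⟩ := ι.surjective i
    obtain ⟨j, rfl⟩ := ι.surjective j
    rcases i with a | a <;> rcases j with b | b <;>
      simp [hLdef, Matrix.one_apply]
  have hS : IsUnit (reindex ι ι (fromBlocks K₁⁻¹ 0 0 L⁻¹)) := by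
    apply IsUnit.of_mul_eq_one (reindex ι ι (fromBlocks K₁ 0 0 L))
    simp [reindex_apply, submatrix_mul_equiv, fromBlocks_multiply,
      Matrix.nonsing_inv_mul _ hK₁d, Matrix.nonsing_inv_mul _ hLd]
  refine ⟨{ nf := nf, ni := ni, ι := ι
            W := reindex ι ι (fromBlocks K₁⁻¹ 0 0 L⁻¹) * (T⁻¹ * M⁻¹), T := T
            isUnit_W := ?_, isUnit_T := hT
            J := K₁⁻¹ * (μ • K₁ - 1), N := L⁻¹ * K₂
            isNilpotent_N := ?_, E_eq := ?_, A_eq := ?_ }⟩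
  · refine hS.mul (IsUnit.mul ?_ ?_)
    · exact Matrix.isUnit_nonsing_inv_iff.mpr hT
    · exact Matrix.isUnit_nonsing_inv_iff.mpr hMu
  · have hc : Commute L⁻¹ K₂ := by
      have h1 : Commute L K₂ := by
        rw [hLdef]
        exact ((Commute.refl K₂).smul_left μ).sub_left (Commute.one_left K₂)
      have h2 : L⁻¹ * K₂ = L⁻¹ * (K₂ * L) * L⁻¹ := by
        rw [mul_assoc, mul_assoc, Matrix.mul_nonsing_inv _ hLd, mul_one]
      change L⁻¹ * K₂ = K₂ * L⁻¹
      rw [h2, ← h1.eq, ← mul_assoc, Matrix.nonsing_inv_mul _ hLd, one_mul]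
    exact hc.isNilpotent_mul_left hK₂
  · have : reindex ι ι (fromBlocks K₁⁻¹ 0 0 L⁻¹) * (T⁻¹ * M⁻¹) * E * T
        = reindex ι ι (fromBlocks K₁⁻¹ 0 0 L⁻¹) * (T⁻¹ * (M⁻¹ * E) * T) := by
      simp only [mul_assoc]
    rw [this, hfit]
    simp [reindex_apply, submatrix_mul_equiv, fromBlocks_multiply,
      Matrix.nonsing_inv_mul _ hK₁d]
  · have : reindex ι ι (fromBlocks K₁⁻¹ 0 0 L⁻¹) * (T⁻¹ * M⁻¹) * A * T
        = reindex ι ι (fromBlocks K₁⁻¹ 0 0 L⁻¹) * (T⁻¹ * (M⁻¹ * A) * T) := by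
      simp only [mul_assoc]
    rw [this, hA]
    simp [reindex_apply, submatrix_mul_equiv, fromBlocks_multiply,
      Matrix.nonsing_inv_mul _ hLd]

/-- Between two Weierstrass forms of one pencil, the transition matrices are block diagonal. -/
theorem weierstrass_blocks {K : Type*} [Field K] {a b a' b' : ℕ}
    {J : Matrix (Fin a) (Fin a) K} {N : Matrix (Fin b) (Fin b) K}
    {J' : Matrix (Fin a') (Fin a') K} {N' : Matrix (Fin b') (Fin b') K}
    (hN : IsNilpotent N) (hN' : IsNilpotent N')
    {Y Z : Matrix (Fin a ⊕ Fin b) (Fin a' ⊕ Fin b') K}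
    (hE : (fromBlocks 1 0 0 N : Matrix (Fin a ⊕ Fin b) (Fin a ⊕ Fin b) K) * Y
      = Z * (fromBlocks 1 0 0 N' : Matrix (Fin a' ⊕ Fin b') (Fin a' ⊕ Fin b') K))
    (hA : (fromBlocks J 0 0 1 : Matrix (Fin a ⊕ Fin b) (Fin a ⊕ Fin b) K) * Y
      = Z * (fromBlocks J' 0 0 1 : Matrix (Fin a' ⊕ Fin b') (Fin a' ⊕ Fin b') K)) :
    ((fromBlocks 1 0 0 0 : Matrix (Fin a ⊕ Fin b) (Fin a ⊕ Fin b) K) * Y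
        = Y * (fromBlocks 1 0 0 0 : Matrix (Fin a' ⊕ Fin b') (Fin a' ⊕ Fin b') K)) ∧
      ((fromBlocks 1 0 0 0 : Matrix (Fin a ⊕ Fin b) (Fin a ⊕ Fin b) K) * Z
        = Z * (fromBlocks 1 0 0 0 : Matrix (Fin a' ⊕ Fin b') (Fin a' ⊕ Fin b') K)) := by
  rw [← fromBlocks_toBlocks Y, ← fromBlocks_toBlocks Z] at hE hA ⊢
  generalize Y.toBlocks₁₁ = Y₁, Y.toBlocks₁₂ = Y₂, Y.toBlocks₂₁ = Y₃, Y.toBlocks₂₂ = Y₄ at *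
  generalize Z.toBlocks₁₁ = Z₁, Z.toBlocks₁₂ = Z₂, Z.toBlocks₂₁ = Z₃, Z.toBlocks₂₂ = Z₄ at *
  simp only [fromBlocks_multiply, fromBlocks_inj, Matrix.one_mul, Matrix.mul_one, Matrix.zero_mul,
    Matrix.mul_zero, add_zero, zero_add] at hE hA ⊢
  obtain ⟨-, e2, e3, -⟩ := hE
  obtain ⟨-, a2, a3, -⟩ := hA
  have hY₂ : Y₂ = 0 := by
    have h : ∀ k : ℕ, Y₂ = J ^ k * Y₂ * N' ^ k := by
      intro k
      induction k with
      | zero => simp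
      | succ k ih =>
        rw [pow_succ, pow_succ']
        have : J ^ k * J * Y₂ * (N' * N' ^ k) = J ^ k * (J * Y₂ * N') * N' ^ k := by
          simp only [Matrix.mul_assoc]
        rw [this, a2, ← e2]
        exact ih
    obtain ⟨k, hk⟩ := hN'
    rw [h k, hk, Matrix.mul_zero]
  have hY₃ : Y₃ = 0 := by
    have h : ∀ k : ℕ, Y₃ = N ^ k * Y₃ * J' ^ k := by
      intro k
      induction k with
      | zero => simp
      | succ k ih =>
        rw [pow_succ, pow_succ']
        have : N ^ k * N * Y₃ * (J' * J' ^ k) = N ^ k * (N * Y₃ * J') * J' ^ k := by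
          simp only [Matrix.mul_assoc]
        rw [this, e3, ← a3]
        exact ih
    obtain ⟨k, hk⟩ := hN
    rw [h k, hk, Matrix.zero_mul, Matrix.zero_mul]
  have hZ₂ : Z₂ = 0 := by rw [← a2, hY₂, Matrix.mul_zero]
  have hZ₃ : Z₃ = 0 := by rw [← e3, hY₃, Matrix.mul_zero]
  simp [hY₂, hY₃, hZ₂, hZ₃]

namespace WeierstrassForm

variable {K : Type*} [Field K] {n : ℕ} {E A : Matrix (Fin n) (Fin n) K}

/-- The spectral projectors do not depend on the chosen Weierstrass form. -/
theorem projectors_unique (F F' : WeierstrassForm E A) :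
    F.left = F'.left ∧ F.right = F'.right := by
  classical
  have hW := (Matrix.isUnit_iff_isUnit_det _).mp F.isUnit_W
  have hT := (Matrix.isUnit_iff_isUnit_det _).mp F.isUnit_T
  have hW' := (Matrix.isUnit_iff_isUnit_det _).mp F'.isUnit_W
  have hT' := (Matrix.isUnit_iff_isUnit_det _).mp F'.isUnit_T
  set Y := F.T⁻¹ * F'.T with hY
  set Z := F.W * F'.W⁻¹ with hZ
  have key : ∀ M : Matrix (Fin n) (Fin n) K,
      (F.W * M * F.T) * Y = Z * (F'.W * M * F'.T) := by
    intro M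
    calc (F.W * M * F.T) * Y = F.W * M * (F.T * F.T⁻¹) * F'.T := by
          rw [hY]; simp only [Matrix.mul_assoc]
      _ = F.W * M * F'.T := by rw [Matrix.mul_nonsing_inv _ hT, Matrix.mul_one]
      _ = F.W * (F'.W⁻¹ * F'.W) * M * F'.T := by
          rw [Matrix.nonsing_inv_mul _ hW', Matrix.mul_one]
      _ = _ := by rw [hZ]; simp only [Matrix.mul_assoc]
  have sub : ∀ (P : Matrix (Fin F.nf ⊕ Fin F.ni) (Fin F.nf ⊕ Fin F.ni) K)
      (P' : Matrix (Fin F'.nf ⊕ Fin F'.ni) (Fin F'.nf ⊕ Fin F'.ni) K)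
      (U V : Matrix (Fin n) (Fin n) K),
      reindex F.ι F.ι P * U = V * reindex F'.ι F'.ι P' ↔
        P * U.submatrix F.ι F'.ι = V.submatrix F.ι F'.ι * P' := by
    intro P P' U V
    have h1 : (reindex F.ι F.ι P * U).submatrix F.ι F'.ι = P * U.submatrix F.ι F'.ι := by
      rw [← Matrix.submatrix_mul_equiv _ _ F.ι F.ι F'.ι]; simp
    have h2 : (V * reindex F'.ι F'.ι P').submatrix F.ι F'.ι = V.submatrix F.ι F'.ι * P' := by
      rw [← Matrix.submatrix_mul_equiv _ _ F.ι F'.ι F'.ι]; simp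
    rw [← h1, ← h2]
    exact (Matrix.reindex F.ι.symm F'.ι.symm).injective.eq_iff.symm
  have hE := key E
  have hA := key A
  rw [F.E_eq, F'.E_eq, sub] at hE
  rw [F.A_eq, F'.A_eq, sub] at hA
  obtain ⟨c1, c2⟩ := weierstrass_blocks F.isNilpotent_N F'.isNilpotent_N hE hA
  rw [← sub] at c1 c2
  constructor
  · calc F.left = F.W⁻¹ * (reindex F.ι F.ι (fromBlocks 1 0 0 0) * Z) * F'.W := by
          rw [left, hZ]
          simp only [Matrix.mul_assoc]
          rw [Matrix.nonsing_inv_mul _ hW', Matrix.mul_one]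
      _ = (F.W⁻¹ * F.W) * F'.W⁻¹ * reindex F'.ι F'.ι (fromBlocks 1 0 0 0) * F'.W := by
          rw [c2, hZ]; simp only [Matrix.mul_assoc]
      _ = F'.left := by rw [Matrix.nonsing_inv_mul _ hW, Matrix.one_mul, left]
  · calc F.right = F.T * (reindex F.ι F.ι (fromBlocks 1 0 0 0) * Y) * F'.T⁻¹ := by
          rw [right, hY]
          simp only [Matrix.mul_assoc]
          rw [Matrix.mul_nonsing_inv _ hT', Matrix.mul_one]
      _ = (F.T * F.T⁻¹) * F'.T * reindex F'.ι F'.ι (fromBlocks 1 0 0 0) * F'.T⁻¹ := by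
          rw [c1, hY]; simp only [Matrix.mul_assoc]
      _ = F'.right := by rw [Matrix.mul_nonsing_inv _ hT, Matrix.one_mul, right]

/-- Extension of scalars of a Weierstrass form. -/
def map {L : Type*} [Field L] (f : K →+* L) (F : WeierstrassForm E A) :
    WeierstrassForm (E.map f) (A.map f) where
  nf := F.nf
  ni := F.ni
  ι := F.ι
  W := F.W.map f
  T := F.T.map f
  isUnit_W := F.isUnit_W.map f.mapMatrix
  isUnit_T := F.isUnit_T.map f.mapMatrix
  J := F.J.map f
  N := F.N.map f
  isNilpotent_N := F.isNilpotent_N.map f.mapMatrix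
  E_eq := by
    rw [← Matrix.map_mul, ← Matrix.map_mul, F.E_eq]
    simp [reindex_apply, ← Matrix.submatrix_map, fromBlocks_map]
  A_eq := by
    rw [← Matrix.map_mul, ← Matrix.map_mul, F.A_eq]
    simp [reindex_apply, ← Matrix.submatrix_map, fromBlocks_map]

/-- The spectral projectors computed over any extension field, for instance from a complex
Jordan-type Weierstrass form of a real pencil, are the same. -/
theorem projectors_map {L : Type*} [Field L] (f : K →+* L) (F : WeierstrassForm E A)
    (F' : WeierstrassForm (E.map f) (A.map f)) :
    F'.left = F.left.map f ∧ F'.right = F.right.map f := by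
  have hinv : ∀ M : Matrix (Fin n) (Fin n) K, IsUnit M → (M.map f)⁻¹ = M⁻¹.map f := by
    intro M hM
    apply Matrix.inv_eq_left_inv
    rw [← Matrix.map_mul, Matrix.nonsing_inv_mul _ ((Matrix.isUnit_iff_isUnit_det _).mp hM)]
    simp
  have h := projectors_unique F' (F.map f)
  rw [h.1, h.2]
  constructor
  · simp only [left, map, hinv _ F.isUnit_W, Matrix.map_mul, reindex_apply]
    simp [← Matrix.submatrix_map, fromBlocks_map]
    rfl
  · simp only [right, map, hinv _ F.isUnit_T, Matrix.map_mul, reindex_apply]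
    simp [← Matrix.submatrix_map, fromBlocks_map]
    rfl

end WeierstrassForm

namespace DescriptorSystem

variable {n m p : ℕ}

/-- The pencil `λ E - A` of the system is regular. -/
def IsRegular (S : DescriptorSystem n m p) : Prop := IsRegularPencil S.E S.A

/-- `P_ℓ`, the spectral projector onto the left deflating subspace of the finite eigenvalues. -/
noncomputable def leftProjector (S : DescriptorSystem n m p) (h : S.IsRegular) :
    Matrix (Fin n) (Fin n) ℝ :=
  (Classical.choice h.exists_weierstrassForm).left

/-- `P_r`, the spectral projector onto the right deflating subspace of the finite eigenvalues. -/
noncomputable def rightProjector (S : DescriptorSystem n m p) (h : S.IsRegular) :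
    Matrix (Fin n) (Fin n) ℝ :=
  (Classical.choice h.exists_weierstrassForm).right

/-- R-controllability: `rank [λ E - A, B] = n` for all complex `λ`. -/
def RControllable (S : DescriptorSystem n m p) : Prop :=
  ∀ z : ℂ, (fromCols (matrixPencil S.E S.A z) (S.B.map (algebraMap ℝ ℂ))).rank = n

/-- R-observability: `rank [λ E - A; C] = n` for all complex `λ`. -/
def RObservable (S : DescriptorSystem n m p) : Prop :=
  ∀ z : ℂ, (fromRows (matrixPencil S.E S.A z) (S.C.map (algebraMap ℝ ℂ))).rank = n

/-- The transfer function `G(z) = C (z E - A)⁻¹ B + D`, at a complex number `z` or, as a matrix of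
rational functions, at the indeterminate. -/
noncomputable def transfer (S : DescriptorSystem n m p) {K : Type*} [Field K] [Algebra ℝ K]
    (z : K) : Matrix (Fin p) (Fin m) K :=
  S.C.map (algebraMap ℝ K) * (matrixPencil S.E S.A z)⁻¹ * S.B.map (algebraMap ℝ K)
    + S.D.map (algebraMap ℝ K)

/-- `G(s) G(-s)ᵀ = ς² I` for all complex `s` for which both `G(s)` and `G(-s)` are defined by the
formula `C (s E - A)⁻¹ B + D`. -/
def IsAllPass (S : DescriptorSystem n m m) (ς : ℝ) : Prop :=
  ∀ s : ℂ, (matrixPencil S.E S.A s).det ≠ 0 → (matrixPencil S.E S.A (-s)).det ≠ 0 →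
    S.transfer s * (S.transfer (-s))ᵀ = ((ς : ℂ) ^ 2) • (1 : Matrix (Fin m) (Fin m) ℂ)

/-- The polynomial part of the transfer function: entrywise, the quotient of the numerator by the
denominator. -/
noncomputable def polynomialPart (S : DescriptorSystem n m p) : Matrix (Fin p) (Fin m) ℝ[X] :=
  (S.transfer (RatFunc.X : RatFunc ℝ)).map fun f => f.num / f.denom

/-- The strictly proper part of the transfer function. -/
noncomputable def strictlyProperPart (S : DescriptorSystem n m p) :
    Matrix (Fin p) (Fin m) (RatFunc ℝ) :=
  S.transfer (RatFunc.X : RatFunc ℝ) - S.polynomialPart.map (algebraMap ℝ[X] (RatFunc ℝ))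

/-- The coefficient `M_k` of `s ^ k` in the polynomial part of the transfer function. -/
noncomputable def polynomialCoeff (S : DescriptorSystem n m p) (k : ℕ) :
    Matrix (Fin p) (Fin m) ℝ :=
  S.polynomialPart.map fun q => q.coeff k

/-- Every entry of the strictly proper part has a numerator of smaller degree than its
denominator. -/
theorem strictlyProperPart_degree_lt (S : DescriptorSystem n m p) (i : Fin p) (j : Fin m) :
    (S.strictlyProperPart i j).num.degree < (S.strictlyProperPart i j).denom.degree := by
  set f := S.transfer (RatFunc.X : RatFunc ℝ) i j with hf
  have hd : f.denom ≠ 0 := f.denom_ne_zero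
  have hd' : algebraMap ℝ[X] (RatFunc ℝ) f.denom ≠ 0 := RatFunc.algebraMap_ne_zero hd
  have hr : S.strictlyProperPart i j
      = algebraMap ℝ[X] (RatFunc ℝ) (f.num % f.denom) / algebraMap ℝ[X] (RatFunc ℝ) f.denom := by
    have h1 : S.strictlyProperPart i j = f - algebraMap ℝ[X] (RatFunc ℝ) (f.num / f.denom) := rfl
    rw [h1, eq_div_iff hd', sub_mul, ← map_mul]
    conv_lhs => rw [← RatFunc.num_div_denom f]
    rw [RatFunc.num_div_denom f]
    have h2 : f * algebraMap ℝ[X] (RatFunc ℝ) f.denom = algebraMap ℝ[X] (RatFunc ℝ) f.num := by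
      conv_lhs => rw [← RatFunc.num_div_denom f]
      rw [RatFunc.num_div_denom f]
      exact (eq_div_iff hd').mp (RatFunc.num_div_denom f).symm
    rw [h2, ← map_sub]
    congr 1
    have := EuclideanDomain.div_add_mod f.num f.denom
    linear_combination -this
  have hcross : (S.strictlyProperPart i j).num * f.denom
      = (f.num % f.denom) * (S.strictlyProperPart i j).denom :=
    (RatFunc.num_mul_eq_mul_denom_iff hd).mpr hr
  set r := S.strictlyProperPart i j
  by_cases h0 : r.num = 0
  · rw [h0, degree_zero, bot_lt_iff_ne_bot, Ne, degree_eq_bot]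
    exact r.denom_ne_zero
  have hlt : (f.num % f.denom).degree < f.denom.degree := EuclideanDomain.mod_lt _ hd
  by_contra! hle
  have h1 := congrArg degree hcross
  rw [degree_mul, degree_mul] at h1
  have hm0 : f.num % f.denom ≠ 0 := by
    intro hz
    rw [hz, zero_mul] at hcross
    exact (mul_ne_zero h0 hd) hcross
  rw [degree_eq_natDegree h0, degree_eq_natDegree hd, degree_eq_natDegree hm0,
    degree_eq_natDegree r.denom_ne_zero] at h1
  rw [degree_eq_natDegree h0, degree_eq_natDegree r.denom_ne_zero] at hle
  rw [degree_eq_natDegree hm0, degree_eq_natDegree hd] at hlt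
  norm_cast at h1 hle hlt
  omega

end DescriptorSystem

/-!
Let `T₁` and `W₁` be the columns of `T` and the rows of `W` that belong to the finite eigenvalues.
Then `G` is the sum of the strictly proper transfer function of the standard state-space system
`(J, W₁ B, C T₁)` and of a polynomial that comes from the nilpotent block. If `G` is all-pass and
`M_l` is the leading coefficient with `l ≥ 1`, dividing `G(s) G(-s)ᵀ = ς²` by `s ^ l (-s) ^ l` and
letting `s → ∞` along the reals gives `M_l M_lᵀ = 0`, so `M_l = 0`. Hence `G` is the transfer
function of `(J, W₁ B, C T₁, M₀)`, a minimal system by the two rank conditions.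

For such a system the all-pass identity says that `G(-s)ᵀ` and `ς² G(s)⁻¹` are the same function.
Both have an obvious minimal realization, and the intertwiner of the two realizations is, up to sign
and scaling, a symmetric invertible solution `X` of the controllability Lyapunov equation that
satisfies the coupling constraint; `Y = ς² X⁻¹` solves the dual equations. Conversely, the Lyapunov
equation and the coupling constraint make the product `G(s) G(-s)ᵀ` collapse to `M₀ M₀ᵀ`. The
substitutions `Gpc = T₁ X T₁ᵀ` and `Gpo = W₁ᵀ Y W₁` translate between `X`, `Y` and the projected
Gramians.
-/

section ProperSystems

variable {ν ν' μ κ α : Type*} [Fintype ν] [DecidableEq ν] [Fintype ν']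
  {K L : Type*} [Field K] [Field L]

theorem neg_nonsing_inv {R : Type*} [CommRing R] (M : Matrix ν ν R) : (-M)⁻¹ = -M⁻¹ := by
  by_cases hM : IsUnit M.det
  · exact Matrix.inv_eq_left_inv (by rw [neg_mul_neg, Matrix.nonsing_inv_mul _ hM])
  · have hM' : ¬ IsUnit (-M).det := fun h => hM (isUnit_of_mul_isUnit_right (det_neg M ▸ h))
    rw [Matrix.nonsing_inv_apply_not_isUnit _ hM, Matrix.nonsing_inv_apply_not_isUnit _ hM',
      neg_zero]

theorem map_nonsing_inv (f : K →+* L) (M : Matrix ν ν K) : M⁻¹.map f = (M.map f)⁻¹ := by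
  rw [Matrix.inv_def, Matrix.inv_def, Ring.inverse_eq_inv', Ring.inverse_eq_inv',
    Matrix.map_smul' f _ _ (map_mul f), map_inv₀, f.map_det, ← f.mapMatrix_apply, f.map_adjugate,
    f.mapMatrix_apply]

/-- The transfer function `D + C (s - A)⁻¹ B` of the state-space system
`x' = A x + B u`, `y = C x + D u`. -/
noncomputable def properTransfer (A : Matrix ν ν K) (B : Matrix ν μ K) (C : Matrix κ ν K)
    (D : Matrix κ μ K) (s : K) : Matrix κ μ K :=
  D + C * (s • (1 : Matrix ν ν K) - A)⁻¹ * B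

theorem transpose_properTransfer (A : Matrix ν ν K) (B : Matrix ν μ K) (C : Matrix κ ν K)
    (D : Matrix κ μ K) (s : K) :
    (properTransfer A B C D s)ᵀ = properTransfer Aᵀ Cᵀ Bᵀ Dᵀ s := by
  simp [properTransfer, Matrix.transpose_nonsing_inv, Matrix.mul_assoc]

theorem properTransfer_neg (A : Matrix ν ν K) (B : Matrix ν μ K) (C : Matrix κ ν K)
    (D : Matrix κ μ K) (s : K) :
    properTransfer A B C D (-s) = properTransfer (-A) (-B) C D s := by
  have hpencil : (-s) • (1 : Matrix ν ν K) - A = -(s • 1 - -A) := by rw [neg_smul]; abel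
  rw [properTransfer, properTransfer, hpencil, neg_nonsing_inv, Matrix.mul_neg, Matrix.neg_mul,
    Matrix.mul_neg]

theorem properTransfer_inverse_mul [Fintype μ] [DecidableEq μ] {A : Matrix ν ν K}
    {B : Matrix ν μ K} {C : Matrix μ ν K} {D D' : Matrix μ μ K} (hD : D' * D = 1) {s : K}
    (hA : IsUnit (s • (1 : Matrix ν ν K) - A).det)
    (hA' : IsUnit (s • (1 : Matrix ν ν K) - (A - B * D' * C)).det) :
    properTransfer (A - B * D' * C) (B * D') (-(D' * C)) D' s * properTransfer A B C D s = 1 := by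
  set P := s • (1 : Matrix ν ν K) - A with hP
  set Q := s • (1 : Matrix ν ν K) - (A - B * D' * C) with hQ
  have hQP : Q⁻¹ * (B * D' * C) * P⁻¹ = P⁻¹ - Q⁻¹ := by
    have : B * D' * C = Q - P := by rw [hQ, hP]; abel
    rw [this, Matrix.mul_sub, Matrix.nonsing_inv_mul _ hA', Matrix.sub_mul, Matrix.one_mul,
      Matrix.mul_nonsing_inv_cancel_right _ _ hA]
  calc (D' + -(D' * C) * Q⁻¹ * (B * D')) * (D + C * P⁻¹ * B)
      = D' * D + D' * C * P⁻¹ * B - D' * C * Q⁻¹ * B * (D' * D)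
          - D' * C * (Q⁻¹ * (B * D' * C) * P⁻¹) * B := by
        simp only [Matrix.mul_add, Matrix.add_mul, Matrix.neg_mul, Matrix.mul_assoc]
        abel
    _ = 1 := by
        rw [hD, hQP, Matrix.mul_one, Matrix.mul_sub, Matrix.sub_mul]
        abel

/-- Observability of the pair `(A, C)`: the only state whose output vanishes identically is zero.
The output of the autonomous system is encoded by its derivatives `C A ^ k v` at time zero. -/
def IsObservablePair (A : Matrix ν ν K) (C : Matrix κ ν K) : Prop :=
  ∀ v : ν → K, (∀ k : ℕ, (C * A ^ k) *ᵥ v = 0) → v = 0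

/-- Controllability of the pair `(A, B)`, encoded as observability of the dual pair. -/
def IsControllablePair (A : Matrix ν ν K) (B : Matrix ν μ K) : Prop :=
  IsObservablePair Aᵀ Bᵀ

theorem mul_pow_of_mul_eq [DecidableEq ν'] {Z : Matrix ν' ν K} {A : Matrix ν ν K}
    {A' : Matrix ν' ν' K} (h : Z * A = A' * Z) (k : ℕ) : Z * A ^ k = A' ^ k * Z := by
  induction k with
  | zero => simp
  | succ k ih =>
    rw [pow_succ, ← Matrix.mul_assoc, ih, Matrix.mul_assoc, h, ← Matrix.mul_assoc, pow_succ]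

namespace IsObservablePair

variable {A : Matrix ν ν K} {C : Matrix κ ν K}

theorem eq_zero_of_mul (h : IsObservablePair A C) {M : Matrix ν α K}
    (hM : ∀ k : ℕ, C * A ^ k * M = 0) : M = 0 := by
  ext i j
  refine congrFun (h (M.col j) fun k => ?_) i
  ext i
  exact congrFun (congrFun (hM k) i) j

theorem eq_zero_of_intertwines (h : IsObservablePair A C) {M : Matrix ν ν' K}
    {R : Matrix ν' ν' K} (hA : M * R = A * M) (hC : C * M = 0) : M = 0 := by
  classical
  exact h.eq_zero_of_mul fun k => by
    rw [Matrix.mul_assoc, ← mul_pow_of_mul_eq hA, ← Matrix.mul_assoc, hC, Matrix.zero_mul]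

theorem injective_of_intertwines (h : IsObservablePair A C) {A' : Matrix ν' ν' K}
    {C' : Matrix κ ν' K} {Z : Matrix ν' ν K} (hA : Z * A = A' * Z) (hC : C' * Z = C) :
    Function.Injective Z.mulVec := by
  classical
  refine (injective_iff_map_eq_zero Z.mulVecLin).mpr fun v hv => h v fun k => ?_
  rw [← hC, Matrix.mul_assoc, mul_pow_of_mul_eq hA, ← Matrix.mul_assoc, ← Matrix.mulVec_mulVec]
  exact (congrArg _ hv).trans (Matrix.mulVec_zero _)

theorem neg (h : IsObservablePair A C) : IsObservablePair (-A) C := by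
  intro v hv
  refine h v fun k => ?_
  obtain hk | hk := neg_one_pow_eq_or (Matrix ν ν K) k <;>
    simpa [neg_pow A, hk, Matrix.neg_mulVec] using hv k

theorem mul_left [Fintype κ] (h : IsObservablePair A C) {U : Matrix μ κ K}
    (hU : Function.Injective U.mulVec) : IsObservablePair A (U * C) := by
  intro v hv
  refine h v fun k => hU ?_
  rw [Matrix.mulVec_mulVec, ← Matrix.mul_assoc, hv k, Matrix.mulVec_zero]

theorem output_injection [Fintype κ] (h : IsObservablePair A C) (L : Matrix ν κ K) :
    IsObservablePair (A - L * C) C := by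
  intro v hv
  have hpow (k : ℕ) : (A - L * C) ^ k *ᵥ v = A ^ k *ᵥ v := by
    induction k with
    | zero => simp
    | succ k ih =>
      have hCk : C *ᵥ (A - L * C) ^ k *ᵥ v = 0 := by rw [Matrix.mulVec_mulVec, hv k]
      rw [pow_succ', pow_succ', ← Matrix.mulVec_mulVec, ← Matrix.mulVec_mulVec, Matrix.sub_mulVec,
        ← Matrix.mulVec_mulVec _ L, hCk, Matrix.mulVec_zero, sub_zero, ih]
  exact h v fun k => by rw [← Matrix.mulVec_mulVec, ← hpow, Matrix.mulVec_mulVec, hv k]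

theorem of_map (f : K →+* L) (h : IsObservablePair (A.map f) (C.map f)) :
    IsObservablePair A C := by
  intro v hv
  have hfv : f ∘ v = 0 := h _ fun k => by
    rw [← f.mapMatrix_apply A, ← map_pow, f.mapMatrix_apply, ← Matrix.map_mul]
    ext i
    rw [← f.map_mulVec, hv k, Pi.zero_apply, Pi.zero_apply, map_zero]
  ext i
  exact f.injective ((congrFun hfv i).trans (map_zero f).symm)

/-- The Popov–Belevitch–Hautus test: the unobservable subspace is invariant under `A`, so over an
algebraically closed field it contains an eigenvector unless it is zero. -/
theorem of_eigenvectors [IsAlgClosed K]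
    (h : ∀ (z : K) (v : ν → K), A *ᵥ v = z • v → C *ᵥ v = 0 → v = 0) :
    IsObservablePair A C := by
  let U : Submodule K (ν → K) := ⨅ k : ℕ, LinearMap.ker (C * A ^ k).mulVecLin
  have mem_U (v : ν → K) : v ∈ U ↔ ∀ k : ℕ, (C * A ^ k) *ᵥ v = 0 := by
    simp only [U, Submodule.mem_iInf, LinearMap.mem_ker, Matrix.mulVecLin_apply]
  have mulVec_mem_U : ∀ v ∈ U, A.mulVecLin v ∈ U := fun v hv => by
    rw [mem_U] at hv ⊢
    intro k
    rw [Matrix.mulVecLin_apply, Matrix.mulVec_mulVec, Matrix.mul_assoc, ← pow_succ, hv (k + 1)]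
  suffices U = ⊥ from fun v hv => (Submodule.eq_bot_iff U).mp this v ((mem_U v).mpr hv)
  by_contra hU
  have : Nontrivial U := Submodule.nontrivial_iff_ne_bot.mpr hU
  obtain ⟨z, hz⟩ := Module.End.exists_eigenvalue (A.mulVecLin.restrict mulVec_mem_U)
  obtain ⟨v, hv⟩ := hz.exists_hasEigenvector
  have hAv : A *ᵥ (v : ν → K) = z • (v : ν → K) := congrArg Subtype.val hv.apply_eq_smul
  have hCv : C *ᵥ (v : ν → K) = 0 := by simpa using (mem_U v).mp v.2 0
  exact hv.2 (Subtype.ext (h z v hAv hCv))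

end IsObservablePair

theorem IsControllablePair.eq_zero_of_mul {A : Matrix ν ν K} {B : Matrix ν μ K}
    (h : IsControllablePair A B) {M : Matrix α ν K} (hM : ∀ k : ℕ, M * (A ^ k * B) = 0) :
    M = 0 := by
  rw [← Matrix.transpose_eq_zero]
  refine IsObservablePair.eq_zero_of_mul h fun k => ?_
  rw [← Matrix.transpose_pow, ← Matrix.transpose_mul, ← Matrix.transpose_mul, hM k,
    Matrix.transpose_zero]

/-- The linear map sending the formal sum `∑ aₖⱼ (k, j)` to the combination `∑ aₖⱼ A ^ k bⱼ` of the
columns of the controllability matrix `[B, A B, A² B, …]`. -/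
noncomputable def reachMap (A : Matrix ν ν K) (B : Matrix ν μ K) : (ℕ × μ →₀ K) →ₗ[K] ν → K :=
  Finsupp.linearCombination K fun q => (A ^ q.1 * B).col q.2

theorem reachMap_single (A : Matrix ν ν K) (B : Matrix ν μ K) (k : ℕ) (j : μ) :
    reachMap A B (Finsupp.single (k, j) 1) = (A ^ k * B).col j := by
  rw [reachMap, Finsupp.linearCombination_single, one_smul]

theorem mulVec_reachMap_eq [DecidableEq ν'] {A : Matrix ν ν K} {B : Matrix ν μ K}
    {C : Matrix κ ν K} {A' : Matrix ν' ν' K} {B' : Matrix ν' μ K} {C' : Matrix κ ν' K}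
    (h : ∀ k : ℕ, C * A ^ k * B = C' * A' ^ k * B') (k : ℕ) (p : ℕ × μ →₀ K) :
    (C * A ^ k) *ᵥ reachMap A B p = (C' * A' ^ k) *ᵥ reachMap A' B' p := by
  suffices (C * A ^ k).mulVecLin ∘ₗ reachMap A B = (C' * A' ^ k).mulVecLin ∘ₗ reachMap A' B' from
    LinearMap.congr_fun this p
  refine Finsupp.lhom_ext' fun ⟨l, j⟩ => LinearMap.ext_ring ?_
  have hkl : C * A ^ k * (A ^ l * B) = C' * A' ^ k * (A' ^ l * B') := by
    simpa only [pow_add, Matrix.mul_assoc] using h (k + l)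
  simp only [LinearMap.comp_apply, Finsupp.lsingle_apply, reachMap_single, Matrix.mulVecLin_apply]
  ext i
  exact congrFun (congrFun hkl i) j

theorem IsControllablePair.surjective_reachMap {A : Matrix ν ν K} {B : Matrix ν μ K}
    (h : IsControllablePair A B) : Function.Surjective (reachMap A B) := by
  rw [← LinearMap.range_eq_top]
  by_contra hne
  obtain ⟨f, hf, hker⟩ := Submodule.exists_le_ker_of_lt_top _ (lt_top_iff_ne_top.mpr hne)
  obtain ⟨w, rfl⟩ := (dotProductEquiv K ν).surjective f
  refine hf ((LinearEquiv.map_eq_zero_iff _).mpr (h w fun k => ?_))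
  rw [← Matrix.transpose_pow, ← Matrix.transpose_mul, Matrix.mulVec_transpose]
  ext j
  change w ⬝ᵥ (A ^ k * B).col j = 0
  simpa [reachMap_single] using hker (LinearMap.mem_range_self _ (Finsupp.single (k, j) 1))

/-- If `reachMap A B p = 0`, then `C' A' ^ k` vanishes at `reachMap A' B' p` for all `k`, because
these vectors depend only on the Markov parameters. Since `(A', C')` is observable, `reachMap A' B'`
therefore factors through `reachMap A B`, and `Z` is the factor. -/
theorem IsControllablePair.exists_intertwiner [DecidableEq ν'] {A : Matrix ν ν K}
    {B : Matrix ν μ K} {C : Matrix κ ν K} {A' : Matrix ν' ν' K} {B' : Matrix ν' μ K}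
    {C' : Matrix κ ν' K}
    (hc : IsControllablePair A B) (ho : IsObservablePair A' C')
    (h : ∀ k : ℕ, C * A ^ k * B = C' * A' ^ k * B') :
    ∃ Z : Matrix ν' ν K, Z * A = A' * Z ∧ Z * B = B' ∧ C' * Z = C := by
  obtain ⟨g, hg⟩ := (reachMap A B).exists_rightInverse_of_surjective
    (LinearMap.range_eq_top.mpr hc.surjective_reachMap)
  have hker (p) (hp : reachMap A B p = 0) : reachMap A' B' p = 0 := ho _ fun k => by
    rw [← mulVec_reachMap_eq h, hp, Matrix.mulVec_zero]
  have hfactor (p) : reachMap A' B' (g (reachMap A B p)) = reachMap A' B' p := by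
    rw [← sub_eq_zero, ← map_sub]
    refine hker _ ?_
    rw [map_sub, sub_eq_zero]
    exact LinearMap.congr_fun hg _
  set Z := LinearMap.toMatrix' (reachMap A' B' ∘ₗ g)
  have hZ (k : ℕ) : Z * (A ^ k * B) = A' ^ k * B' := by
    ext i j
    have hcol : Z *ᵥ (A ^ k * B).col j = (A' ^ k * B').col j := by
      rw [LinearMap.toMatrix'_mulVec, ← reachMap_single, LinearMap.comp_apply, hfactor,
        reachMap_single]
    exact congrFun hcol i
  refine ⟨Z, sub_eq_zero.mp (hc.eq_zero_of_mul fun k => ?_), by simpa using hZ 0,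
    sub_eq_zero.mp (hc.eq_zero_of_mul fun k => ?_)⟩
  · rw [Matrix.sub_mul, Matrix.mul_assoc, Matrix.mul_assoc, hZ, ← Matrix.mul_assoc A, ← pow_succ',
      hZ, pow_succ', Matrix.mul_assoc, sub_self]
  · rw [Matrix.sub_mul, Matrix.mul_assoc, hZ, ← Matrix.mul_assoc, ← Matrix.mul_assoc, h, sub_self]

end ProperSystems

section AllPass

variable {ν μ κ : Type*} [Fintype ν] [Fintype μ] {K L : Type*} [Field K] [Field L]

theorem mul_eq_smul_one_comm [DecidableEq ν] {c : K} (hc : c ≠ 0) {M N : Matrix ν ν K}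
    (h : M * N = c • 1) : N * M = c • 1 := by
  have hinv : (c⁻¹ • M) * N = 1 := by
    rw [Matrix.smul_mul, h, smul_smul, inv_mul_cancel₀ hc, one_smul]
  rw [← mul_eq_one_comm.mp hinv, Matrix.mul_smul, smul_smul, mul_inv_cancel₀ hc, one_smul]

/-- A solution `X` of the Lyapunov equation of a state-space system that satisfies the coupling
constraint with the feedthrough `D`. Such an `X` certifies that the transfer function `G`
satisfies `G(s) G(-s)ᵀ = c`. -/
structure IsAllPassGramian (A : Matrix ν ν K) (B : Matrix ν μ K) (C : Matrix κ ν K)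
    (D : Matrix κ μ K) [DecidableEq κ] (c : K) (X : Matrix ν ν K) : Prop where
  isSymm : X.IsSymm
  lyapunov : X * Aᵀ + A * X + B * Bᵀ = 0
  feedthrough : D * Dᵀ = c • (1 : Matrix κ κ K)
  coupling : D * Bᵀ + C * X = 0

namespace IsAllPassGramian

variable {A X : Matrix ν ν K} {B : Matrix ν μ K}

section

variable [DecidableEq κ] {C : Matrix κ ν K} {D : Matrix κ μ K} {c : K}

theorem coupling_transpose (h : IsAllPassGramian A B C D c X) : B * Dᵀ + X * Cᵀ = 0 := by
  have := congrArg Matrix.transpose h.coupling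
  rwa [Matrix.transpose_add, Matrix.transpose_mul, Matrix.transpose_mul, h.isSymm.eq,
    Matrix.transpose_transpose, Matrix.transpose_zero] at this

theorem map (h : IsAllPassGramian A B C D c X) (f : K →+* L) :
    IsAllPassGramian (A.map f) (B.map f) (C.map f) (D.map f) (f c) (X.map f) where
  isSymm := h.isSymm.map f
  lyapunov := by
    simpa [Matrix.map_mul, Matrix.map_add, Matrix.transpose_map] using
      congrArg (fun M => M.map f) h.lyapunov
  feedthrough := by
    simpa [Matrix.map_mul, Matrix.transpose_map, Matrix.map_smul'] using
      congrArg (fun M => M.map f) h.feedthrough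
  coupling := by
    simpa [Matrix.map_mul, Matrix.map_add, Matrix.transpose_map] using
      congrArg (fun M => M.map f) h.coupling

theorem properTransfer_mul_transpose [DecidableEq ν] (h : IsAllPassGramian A B C D c X) {s : K}
    (hs : IsUnit (s • (1 : Matrix ν ν K) - A).det)
    (hs' : IsUnit ((-s) • (1 : Matrix ν ν K) - A).det) :
    properTransfer A B C D s * (properTransfer A B C D (-s))ᵀ = c • 1 := by
  rw [transpose_properTransfer]
  set P := s • (1 : Matrix ν ν K) - A with hP
  set Q := (-s) • (1 : Matrix ν ν K) - Aᵀ with hQ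
  have hQu : IsUnit Q.det := by
    rw [hQ]
    simpa using Matrix.isUnit_det_transpose _ hs'
  have hBB : P⁻¹ * (B * Bᵀ) * Q⁻¹ = X * Q⁻¹ + P⁻¹ * X := by
    have hPQ : B * Bᵀ = P * X + X * Q := by
      rw [eq_neg_of_add_eq_zero_right h.lyapunov, hP, hQ]
      simp only [Matrix.sub_mul, Matrix.mul_sub, Matrix.smul_mul, Matrix.mul_smul, Matrix.one_mul,
        Matrix.mul_one, neg_smul, Matrix.mul_neg]
      abel
    rw [hPQ, Matrix.mul_add, Matrix.nonsing_inv_mul_cancel_left _ _ hs, Matrix.add_mul,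
      ← Matrix.mul_assoc, Matrix.mul_nonsing_inv_cancel_right _ _ hQu]
  calc (D + C * P⁻¹ * B) * (Dᵀ + Bᵀ * Q⁻¹ * Cᵀ)
      = D * Dᵀ + D * Bᵀ * (Q⁻¹ * Cᵀ) + C * P⁻¹ * (B * Dᵀ)
          + C * (P⁻¹ * (B * Bᵀ) * Q⁻¹) * Cᵀ := by
        simp only [Matrix.mul_add, Matrix.add_mul, Matrix.mul_assoc]
        abel
    _ = c • 1 := by
        rw [h.feedthrough, hBB, eq_neg_of_add_eq_zero_left h.coupling,
          eq_neg_of_add_eq_zero_left h.coupling_transpose]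
        simp only [Matrix.mul_add, Matrix.add_mul, Matrix.neg_mul, Matrix.mul_neg, Matrix.mul_assoc]
        abel

end

variable [DecidableEq μ] {C : Matrix μ ν K} {D : Matrix μ μ K} {c : K}

theorem feedthrough_transpose (h : IsAllPassGramian A B C D c X) (hc : c ≠ 0) :
    Dᵀ * D = c • 1 :=
  mul_eq_smul_one_comm hc h.feedthrough

theorem dual [DecidableEq ν] (h : IsAllPassGramian A B C D c X) (hc : c ≠ 0) {Y : Matrix ν ν K}
    (hXY : X * Y = c • 1) : IsAllPassGramian Aᵀ Cᵀ Bᵀ Dᵀ c Y := by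
  have hYX : Y * X = c • 1 := mul_eq_smul_one_comm hc hXY
  have hYtX : Yᵀ * X = c • 1 := by
    rw [← h.isSymm.eq, ← Matrix.transpose_mul, hXY, Matrix.transpose_smul, Matrix.transpose_one]
  have hsymm : Yᵀ = Y := smul_right_injective _ hc <|
    calc c • Yᵀ = Yᵀ * (X * Y) := by rw [hXY, Matrix.mul_smul, Matrix.mul_one]
      _ = c • Y := by rw [← Matrix.mul_assoc, hYtX, Matrix.smul_mul, Matrix.one_mul]
  have hcoupling : Dᵀ * C + Bᵀ * Y = 0 := smul_right_injective _ hc <|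
    calc c • (Dᵀ * C + Bᵀ * Y) = Dᵀ * C * (X * Y) + Dᵀ * D * (Bᵀ * Y) := by
          rw [hXY, h.feedthrough_transpose hc]
          simp only [Matrix.mul_smul, Matrix.smul_mul, Matrix.mul_one, Matrix.one_mul, smul_add]
      _ = Dᵀ * (D * Bᵀ + C * X) * Y := by
          simp only [Matrix.mul_add, Matrix.add_mul, Matrix.mul_assoc]
          abel
      _ = c • 0 := by rw [h.coupling, Matrix.mul_zero, Matrix.zero_mul, smul_zero]
  have hYB : Y * B = -(Cᵀ * D) := by
    have := congrArg Matrix.transpose (eq_neg_of_add_eq_zero_right hcoupling)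
    simpa [Matrix.transpose_mul, hsymm] using this
  refine ⟨hsymm, ?_, by simpa using h.feedthrough_transpose hc, by simpa using hcoupling⟩
  refine smul_right_injective _ hc ?_
  calc c • (Y * Aᵀᵀ + Aᵀ * Y + Cᵀ * Cᵀᵀ)
      = Y * X * (Aᵀ * Y) + Y * A * (X * Y) + Cᵀ * (D * Dᵀ) * C := by
        rw [hYX, hXY, h.feedthrough]
        simp only [Matrix.mul_smul, Matrix.smul_mul, Matrix.mul_one, Matrix.one_mul, smul_add,
          Matrix.transpose_transpose]
        abel
    _ = Y * X * (Aᵀ * Y) + Y * A * (X * Y) + Y * B * (Bᵀ * Y) := by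
        rw [hYB, eq_neg_of_add_eq_zero_right hcoupling]
        simp only [Matrix.neg_mul, Matrix.mul_neg, neg_neg, Matrix.mul_assoc]
    _ = Y * (X * Aᵀ + A * X + B * Bᵀ) * Y := by
        simp only [Matrix.mul_add, Matrix.add_mul, Matrix.mul_assoc]
    _ = c • 0 := by rw [h.lyapunov, Matrix.mul_zero, Matrix.zero_mul, smul_zero]

end IsAllPassGramian

theorem IsObservablePair.isSymm_of_lyapunov [DecidableEq ν] {A X : Matrix ν ν K}
    {B : Matrix ν μ K} {C : Matrix κ ν K} {D : Matrix κ μ K} (ho : IsObservablePair A C)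
    (hlyap : X * Aᵀ + A * X + B * Bᵀ = 0) (hCX : D * Bᵀ + C * X = 0)
    (hXC : B * Dᵀ + X * Cᵀ = 0) : X.IsSymm := by
  have hC : C * (Xᵀ - X) = 0 := by
    have := congrArg Matrix.transpose hXC
    simp only [Matrix.transpose_add, Matrix.transpose_mul, Matrix.transpose_transpose,
      Matrix.transpose_zero] at this
    rw [Matrix.mul_sub, sub_eq_zero]
    exact add_left_cancel (this.trans hCX.symm)
  have hA : (Xᵀ - X) * -Aᵀ = A * (Xᵀ - X) := by
    have := congrArg Matrix.transpose hlyap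
    simp only [Matrix.transpose_add, Matrix.transpose_mul, Matrix.transpose_transpose,
      Matrix.transpose_zero] at this
    rw [Matrix.mul_neg, Matrix.mul_sub, Matrix.sub_mul, ← sub_eq_zero, ← neg_eq_zero,
      ← sub_eq_zero.mpr (this.trans hlyap.symm)]
    abel
  exact sub_eq_zero.mp (ho.eq_zero_of_intertwines hA hC)

/-- The two sides of `h` are, up to sign, the Markov parameters of the realizations
`(-Aᵀ, Cᵀ, -Bᵀ)` of `G(-s)ᵀ` and `(A - B D⁻¹ C, B D⁻¹, -Dᵀ C)` of `c G(s)⁻¹`, where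
`D⁻¹ = c⁻¹ Dᵀ`. The Gramian is the intertwiner of these two realizations, rescaled by `-c`. -/
theorem exists_isAllPassGramian_of_markov [DecidableEq ν] [DecidableEq μ] {A : Matrix ν ν K}
    {B : Matrix ν μ K} {C : Matrix μ ν K} {D : Matrix μ μ K} {c : K} (hc0 : c ≠ 0)
    (hc : IsControllablePair A B) (ho : IsObservablePair A C) (hD : D * Dᵀ = c • 1)
    (h : ∀ k : ℕ, Bᵀ * (-Aᵀ) ^ k * Cᵀ
      = Dᵀ * C * (A - B * (c⁻¹ • Dᵀ) * C) ^ k * (B * (c⁻¹ • Dᵀ))) :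
    ∃ X, IsUnit X ∧ IsAllPassGramian A B C D c X := by
  have hDD : Dᵀ * D = c • 1 := mul_eq_smul_one_comm hc0 hD
  have hctrl : IsControllablePair (-Aᵀ) Cᵀ := by
    simpa [IsControllablePair] using ho.neg
  have hobs : IsObservablePair (A - B * (c⁻¹ • Dᵀ) * C) (Dᵀ * C) := by
    refine (ho.output_injection _).mul_left (Matrix.mulVec_injective_iff_isUnit.mpr ?_)
    refine IsUnit.of_mul_eq_one (c⁻¹ • D) ?_
    rw [Matrix.mul_smul, hDD, smul_smul, inv_mul_cancel₀ hc0, one_smul]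
  obtain ⟨Z, hZA, hZC, hCZ⟩ := hctrl.exists_intertwiner hobs h
  have hZ : IsUnit Z :=
    Matrix.mulVec_injective_iff_isUnit.mp (hc.neg.injective_of_intertwines hZA hCZ)
  have hXC : B * Dᵀ + -(c • Z) * Cᵀ = 0 := by
    rw [Matrix.neg_mul, Matrix.smul_mul, hZC, Matrix.mul_smul, smul_smul, mul_inv_cancel₀ hc0,
      one_smul, add_neg_cancel]
  have hCX : D * Bᵀ + C * -(c • Z) = 0 := by
    rw [← hCZ, Matrix.mul_assoc Dᵀ, ← Matrix.mul_assoc, hD, Matrix.smul_mul, Matrix.one_mul,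
      Matrix.mul_neg, Matrix.mul_smul, add_neg_cancel]
  have hlyap : -(c • Z) * Aᵀ + A * -(c • Z) + B * Bᵀ = 0 := by
    have hBB : c • (B * (c⁻¹ • Dᵀ) * C * Z) = B * Bᵀ := by
      rw [Matrix.mul_assoc, Matrix.mul_assoc, ← Matrix.mul_assoc _ C, Matrix.smul_mul _ Dᵀ,
        Matrix.smul_mul, hCZ, Matrix.mul_smul, smul_smul, mul_inv_cancel₀ hc0, one_smul]
    rw [Matrix.neg_mul, ← Matrix.mul_neg, Matrix.smul_mul, hZA, Matrix.sub_mul, smul_sub, hBB,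
      Matrix.mul_neg, Matrix.mul_smul]
    abel
  exact ⟨-(c • Z), (hZ.smul (Units.mk0 c hc0)).neg, ho.isSymm_of_lyapunov hlyap hCX hXC, hlyap, hD,
    hCX⟩

end AllPass

section Limits

open Filter Topology Bornology

variable {ν ν' μ κ : Type*} [Fintype ν] [DecidableEq ν] [Fintype ν'] [DecidableEq ν']
  {𝕜 : Type*} [NontriviallyNormedField 𝕜]

theorem eventually_isUnit_det_smul_one_sub (A : Matrix ν ν 𝕜) :
    ∀ᶠ s in cobounded 𝕜, IsUnit (s • (1 : Matrix ν ν 𝕜) - A).det := by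
  have hroots : (A.charpoly.rootSet 𝕜)ᶜ ∈ cobounded 𝕜 :=
    isBounded_def.mp (A.charpoly.rootSet_finite 𝕜).isBounded
  filter_upwards [hroots] with s hs
  rw [isUnit_iff_ne_zero, Matrix.smul_one_eq_diagonal, ← Matrix.scalar_apply,
    ← Matrix.eval_charpoly]
  simpa [Polynomial.mem_rootSet, A.charpoly_monic.ne_zero] using hs

theorem tendsto_smul_inv_smul_one_sub (A : Matrix ν ν 𝕜) :
    Tendsto (fun s => s • (s • (1 : Matrix ν ν 𝕜) - A)⁻¹) (cobounded 𝕜) (𝓝 1) := by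
  have hlim : Tendsto (fun s => 1 - s⁻¹ • A) (cobounded 𝕜) (𝓝 1) := by
    simpa using tendsto_const_nhds.sub ((tendsto_inv₀_cobounded (α := 𝕜)).smul_const A)
  have hcont : ContinuousAt (Inv.inv : Matrix ν ν 𝕜 → Matrix ν ν 𝕜) 1 := by
    refine continuousAt_matrix_inv _ ?_
    rw [det_one, Ring.inverse_eq_inv']
    exact continuousAt_inv₀ one_ne_zero
  rw [ContinuousAt, inv_one] at hcont
  refine (hcont.comp hlim).congr' ?_
  filter_upwards [eventually_isUnit_det_smul_one_sub A, eventually_ne_cobounded 0] with s hs hs0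
  refine Matrix.inv_eq_left_inv ?_
  rw [Matrix.smul_mul, ← Matrix.mul_smul, smul_sub, smul_smul, mul_inv_cancel₀ hs0, one_smul,
    Matrix.nonsing_inv_mul _ hs]

theorem tendsto_smul_mul_inv_smul_one_sub_mul (A : Matrix ν ν 𝕜) (B : Matrix ν μ 𝕜)
    (C : Matrix κ ν 𝕜) :
    Tendsto (fun s => s • (C * (s • (1 : Matrix ν ν 𝕜) - A)⁻¹ * B)) (cobounded 𝕜) (𝓝 (C * B)) := by
  have hcont : Continuous fun M : Matrix ν ν 𝕜 => C * M * B := by fun_prop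
  simpa [Function.comp_def] using (hcont.tendsto 1).comp (tendsto_smul_inv_smul_one_sub A)

theorem tendsto_properTransfer (A : Matrix ν ν 𝕜) (B : Matrix ν μ 𝕜) (C : Matrix κ ν 𝕜)
    (D : Matrix κ μ 𝕜) :
    Tendsto (properTransfer A B C D) (cobounded 𝕜) (𝓝 D) := by
  have hzero : Tendsto (fun s => C * (s • (1 : Matrix ν ν 𝕜) - A)⁻¹ * B) (cobounded 𝕜) (𝓝 0) := by
    have := (tendsto_inv₀_cobounded (α := 𝕜)).smul (tendsto_smul_mul_inv_smul_one_sub_mul A B C)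
    rw [zero_smul] at this
    refine this.congr' ?_
    filter_upwards [eventually_ne_cobounded 0] with s hs
    rw [smul_smul, inv_mul_cancel₀ hs, one_smul]
  have hadd := (tendsto_const_nhds (x := D)).add hzero
  rw [add_zero] at hadd
  exact hadd

theorem mul_inv_smul_one_sub_mul_mul {K : Type*} [Field K] (A : Matrix ν ν K) (B : Matrix ν μ K)
    (C : Matrix κ ν K) {s : K} (hs : IsUnit (s • (1 : Matrix ν ν K) - A).det) :
    C * (s • (1 : Matrix ν ν K) - A)⁻¹ * (A * B)
      = s • (C * (s • (1 : Matrix ν ν K) - A)⁻¹ * B) - C * B := by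
  have hAB : A * B = s • B - (s • (1 : Matrix ν ν K) - A) * B := by
    rw [Matrix.sub_mul, Matrix.smul_mul, Matrix.one_mul, sub_sub_cancel]
  rw [hAB, Matrix.mul_sub, Matrix.mul_smul, Matrix.mul_assoc C _ (_ * B),
    Matrix.nonsing_inv_mul_cancel_left _ _ hs]

theorem mul_eq_of_eventuallyEq {A : Matrix ν ν 𝕜} {B : Matrix ν μ 𝕜} {C : Matrix κ ν 𝕜}
    {A' : Matrix ν' ν' 𝕜} {B' : Matrix ν' μ 𝕜} {C' : Matrix κ ν' 𝕜}
    (h : ∀ᶠ s in cobounded 𝕜, C * (s • (1 : Matrix ν ν 𝕜) - A)⁻¹ * B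
      = C' * (s • (1 : Matrix ν' ν' 𝕜) - A')⁻¹ * B') : C * B = C' * B' :=
  tendsto_nhds_unique_of_eventuallyEq (tendsto_smul_mul_inv_smul_one_sub_mul A B C)
    (tendsto_smul_mul_inv_smul_one_sub_mul A' B' C') (h.mono fun s hs => congrArg (s • ·) hs)

theorem markov_eq_of_eventuallyEq {A : Matrix ν ν 𝕜} {B : Matrix ν μ 𝕜} {C : Matrix κ ν 𝕜}
    {A' : Matrix ν' ν' 𝕜} {B' : Matrix ν' μ 𝕜} {C' : Matrix κ ν' 𝕜}
    (h : ∀ᶠ s in cobounded 𝕜, C * (s • (1 : Matrix ν ν 𝕜) - A)⁻¹ * B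
      = C' * (s • (1 : Matrix ν' ν' 𝕜) - A')⁻¹ * B') (k : ℕ) :
    C * A ^ k * B = C' * A' ^ k * B' := by
  induction k generalizing B B' with
  | zero => simpa using mul_eq_of_eventuallyEq h
  | succ k ih =>
    have hshift := ih (B := A * B) (B' := A' * B') <| by
      filter_upwards [h, eventually_isUnit_det_smul_one_sub A,
        eventually_isUnit_det_smul_one_sub A'] with s hs hA hA'
      rw [mul_inv_smul_one_sub_mul_mul _ _ _ hA, mul_inv_smul_one_sub_mul_mul _ _ _ hA', hs,
        mul_eq_of_eventuallyEq h]
    simpa only [pow_succ, Matrix.mul_assoc] using hshift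

theorem feedthrough_mul_transpose_eq [Fintype μ] {A : Matrix ν ν 𝕜}
    {B : Matrix ν μ 𝕜} {C : Matrix κ ν 𝕜} {D : Matrix κ μ 𝕜} {Q : Matrix κ κ 𝕜}
    (h : ∀ᶠ s in cobounded 𝕜, properTransfer A B C D s * (properTransfer A B C D (-s))ᵀ = Q) :
    D * Dᵀ = Q := by
  have hlim := tendsto_properTransfer A B C D
  have hcont : Continuous fun M : Matrix κ μ 𝕜 × Matrix κ μ 𝕜 => M.1 * M.2ᵀ := by fun_prop
  have hmul := (hcont.tendsto (D, D)).comp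
    (hlim.prodMk_nhds (hlim.comp (tendsto_neg_cobounded (E := 𝕜))))
  exact tendsto_nhds_unique_of_eventuallyEq hmul tendsto_const_nhds h

theorem exists_isAllPassGramian [Fintype μ] [DecidableEq μ] {A : Matrix ν ν 𝕜}
    {B : Matrix ν μ 𝕜} {C : Matrix μ ν 𝕜} {D : Matrix μ μ 𝕜} {c : 𝕜} (hc0 : c ≠ 0)
    (hc : IsControllablePair A B) (ho : IsObservablePair A C)
    (h : ∀ᶠ s in cobounded 𝕜,
      properTransfer A B C D s * (properTransfer A B C D (-s))ᵀ = c • 1) :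
    ∃ X, IsUnit X ∧ IsAllPassGramian A B C D c X := by
  have hD : D * Dᵀ = c • 1 := feedthrough_mul_transpose_eq h
  have hinv : (c⁻¹ • Dᵀ) * D = 1 := by
    rw [Matrix.smul_mul, mul_eq_smul_one_comm hc0 hD, smul_smul, inv_mul_cancel₀ hc0, one_smul]
  refine exists_isAllPassGramian_of_markov hc0 hc ho hD (markov_eq_of_eventuallyEq ?_)
  filter_upwards [h, eventually_isUnit_det_smul_one_sub A,
    eventually_isUnit_det_smul_one_sub (A - B * (c⁻¹ • Dᵀ) * C)] with s hs hA hA'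
  have hGinv := properTransfer_inverse_mul hinv hA hA'
  have hG : (properTransfer A B C D (-s))ᵀ = c • properTransfer (A - B * (c⁻¹ • Dᵀ) * C)
      (B * (c⁻¹ • Dᵀ)) (-(c⁻¹ • Dᵀ * C)) (c⁻¹ • Dᵀ) s := by
    rw [← Matrix.one_mul (properTransfer A B C D (-s))ᵀ, ← hGinv, Matrix.mul_assoc, hs,
      Matrix.mul_smul, Matrix.mul_one]
  rw [properTransfer_neg, transpose_properTransfer] at hG
  simpa [properTransfer, smul_smul, hc0, Matrix.neg_mul, Matrix.mul_neg] using hG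

end Limits

namespace WeierstrassForm

section Blocks

variable {K : Type*} [Field K] {n : ℕ} {E A : Matrix (Fin n) (Fin n) K}

/-- The columns of `T` which span the right deflating subspace of the finite eigenvalues. -/
def T₁ (F : WeierstrassForm E A) : Matrix (Fin n) (Fin F.nf) K :=
  (F.T.submatrix id F.ι).toCols₁

/-- The columns of `T` which span the right deflating subspace of the infinite eigenvalue. -/
def T₂ (F : WeierstrassForm E A) : Matrix (Fin n) (Fin F.ni) K :=
  (F.T.submatrix id F.ι).toCols₂

/-- The rows of `W` which belong to the finite eigenvalues. -/
def W₁ (F : WeierstrassForm E A) : Matrix (Fin F.nf) (Fin n) K :=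
  (F.W.submatrix F.ι id).toRows₁

/-- The rows of `W` which belong to the infinite eigenvalue. -/
def W₂ (F : WeierstrassForm E A) : Matrix (Fin F.ni) (Fin n) K :=
  (F.W.submatrix F.ι id).toRows₂

/-- The Weierstrass form of the transposed pencil, for the passage to the dual system. -/
def transpose (F : WeierstrassForm E A) : WeierstrassForm Eᵀ Aᵀ where
  nf := F.nf
  ni := F.ni
  ι := F.ι
  W := F.Tᵀ
  T := F.Wᵀ
  isUnit_W := (Matrix.isUnit_transpose F.T).mpr F.isUnit_T
  isUnit_T := (Matrix.isUnit_transpose F.W).mpr F.isUnit_W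
  J := F.Jᵀ
  N := F.Nᵀ
  isNilpotent_N := Matrix.isNilpotent_transpose_iff.mpr F.isNilpotent_N
  E_eq := by
    rw [← Matrix.transpose_mul, ← Matrix.transpose_mul, ← Matrix.mul_assoc, F.E_eq,
      transpose_reindex, fromBlocks_transpose]
    simp only [transpose_one, transpose_zero]
  A_eq := by
    rw [← Matrix.transpose_mul, ← Matrix.transpose_mul, ← Matrix.mul_assoc, F.A_eq,
      transpose_reindex, fromBlocks_transpose]
    simp only [transpose_one, transpose_zero]

variable (F : WeierstrassForm E A)

theorem fromBlocks_mul_mul {M : Matrix (Fin n) (Fin n) K}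
    {Q : Matrix (Fin F.nf ⊕ Fin F.ni) (Fin F.nf ⊕ Fin F.ni) K}
    (h : F.W * M * F.T = reindex F.ι F.ι Q) :
    fromBlocks (F.W₁ * M * F.T₁) (F.W₁ * M * F.T₂) (F.W₂ * M * F.T₁) (F.W₂ * M * F.T₂) = Q := by
  rw [← fromRows_mul_fromCols, ← fromRows_mul, W₁, W₂, T₁, T₂, fromRows_toRows, fromCols_toCols]
  calc F.W.submatrix F.ι id * M * F.T.submatrix id F.ι
      = (F.W * M * F.T).submatrix F.ι F.ι := rfl
    _ = Q := by rw [h, reindex_apply, submatrix_submatrix]; simp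

theorem W₁_mul_E_mul_T₁ : F.W₁ * E * F.T₁ = 1 :=
  (fromBlocks_inj.mp (F.fromBlocks_mul_mul F.E_eq)).1

theorem W₁_mul_A_mul_T₁ : F.W₁ * A * F.T₁ = F.J :=
  (fromBlocks_inj.mp (F.fromBlocks_mul_mul F.A_eq)).1

theorem E_mul_T₁_mul_W₁_add : E * F.T₁ * F.W₁ + A * F.T₂ * F.W₂ = 1 := by
  obtain ⟨hE₁₁, -, hE₂₁, -⟩ := fromBlocks_inj.mp (F.fromBlocks_mul_mul F.E_eq)
  obtain ⟨-, hA₁₂, -, hA₂₂⟩ := fromBlocks_inj.mp (F.fromBlocks_mul_mul F.A_eq)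
  have h : fromRows F.W₁ F.W₂ * fromCols (E * F.T₁) (A * F.T₂) = 1 := by
    simp only [fromRows_mul_fromCols, ← Matrix.mul_assoc, hE₁₁, hE₂₁, hA₁₂, hA₂₂, fromBlocks_one]
  rw [← fromCols_mul_fromRows]
  exact (mul_eq_one_comm_of_equiv F.ι).mp h

theorem A_mul_T₁ : A * F.T₁ = E * F.T₁ * F.J := by
  have hA₂₁ : F.W₂ * A * F.T₁ = 0 := (fromBlocks_inj.mp (F.fromBlocks_mul_mul F.A_eq)).2.2.1
  calc A * F.T₁ = (E * F.T₁ * F.W₁ + A * F.T₂ * F.W₂) * (A * F.T₁) := by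
        rw [E_mul_T₁_mul_W₁_add, Matrix.one_mul]
    _ = E * F.T₁ * (F.W₁ * A * F.T₁) + A * F.T₂ * (F.W₂ * A * F.T₁) := by
        simp only [Matrix.add_mul, Matrix.mul_assoc]
    _ = E * F.T₁ * F.J := by rw [F.W₁_mul_A_mul_T₁, hA₂₁, Matrix.mul_zero, add_zero]

theorem E_mul_T₂ : E * F.T₂ = A * F.T₂ * F.N := by
  obtain ⟨-, hE₁₂, -, hE₂₂⟩ := fromBlocks_inj.mp (F.fromBlocks_mul_mul F.E_eq)
  calc E * F.T₂ = (E * F.T₁ * F.W₁ + A * F.T₂ * F.W₂) * (E * F.T₂) := by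
        rw [E_mul_T₁_mul_W₁_add, Matrix.one_mul]
    _ = E * F.T₁ * (F.W₁ * E * F.T₂) + A * F.T₂ * (F.W₂ * E * F.T₂) := by
        simp only [Matrix.add_mul, Matrix.mul_assoc]
    _ = A * F.T₂ * F.N := by rw [hE₁₂, hE₂₂, Matrix.mul_zero, zero_add]

theorem W₁_mul_A : F.W₁ * A = F.J * (F.W₁ * E) := by
  have h : Aᵀ * F.W₁ᵀ = Eᵀ * F.W₁ᵀ * F.Jᵀ := F.transpose.A_mul_T₁
  rwa [← Matrix.transpose_mul, ← Matrix.transpose_mul, ← Matrix.transpose_mul,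
    Matrix.transpose_inj] at h

theorem T₁_mul_W₁ : F.T₁ * F.W₁ = F.T * reindex F.ι F.ι (fromBlocks 1 0 0 0) * F.W := by
  let P : Matrix (Fin F.nf ⊕ Fin F.ni) (Fin F.nf ⊕ Fin F.ni) K := fromBlocks 1 0 0 0
  calc F.T₁ * F.W₁ = F.T.submatrix id F.ι * P * F.W.submatrix F.ι id := by
        rw [← fromCols_toCols (F.T.submatrix id F.ι), ← fromRows_toRows (F.W.submatrix F.ι id),
          fromCols_mul_fromBlocks, fromCols_mul_fromRows, T₁, W₁]
        simp only [Matrix.mul_one, Matrix.mul_zero, Matrix.zero_mul, add_zero]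
    _ = F.T * reindex F.ι F.ι P * F.W := by
        rw [← submatrix_id_id (F.T * reindex F.ι F.ι P * F.W), ← submatrix_mul_equiv _ _ id F.ι id,
          ← submatrix_mul_equiv _ _ id F.ι F.ι, reindex_apply, submatrix_submatrix]
        simp

theorem left_eq : F.left = E * F.T₁ * F.W₁ := by
  have hW := (Matrix.isUnit_iff_isUnit_det _).mp F.isUnit_W
  have hP : reindex F.ι F.ι (fromBlocks 1 0 0 F.N) * reindex F.ι F.ι (fromBlocks 1 0 0 0)
      = reindex F.ι F.ι (fromBlocks 1 0 0 0) := by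
    simp [reindex_apply, submatrix_mul_equiv, fromBlocks_multiply]
  rw [left, ← hP, ← F.E_eq, Matrix.mul_assoc E, T₁_mul_W₁]
  simp only [Matrix.mul_assoc, nonsing_inv_mul_cancel_left _ _ hW]

theorem transpose_left : F.transpose.left = F.rightᵀ := by
  rw [left, right, Matrix.transpose_mul, Matrix.transpose_mul, transpose_nonsing_inv,
    transpose_reindex, fromBlocks_transpose, ← Matrix.mul_assoc]
  simp only [transpose_one, transpose_zero]
  rfl

theorem transpose_right : F.transpose.right = F.leftᵀ := by
  rw [← Matrix.transpose_inj, ← transpose_left]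
  rfl

theorem right_eq : F.right = F.T₁ * F.W₁ * E := by
  have h : F.rightᵀ = Eᵀ * F.W₁ᵀ * F.T₁ᵀ := F.transpose_left.symm.trans F.transpose.left_eq
  rwa [← Matrix.transpose_mul, ← Matrix.transpose_mul, Matrix.transpose_inj,
    ← Matrix.mul_assoc] at h

theorem W₁_mul_pencil (z : K) : F.W₁ * (z • E - A) = (z • 1 - F.J) * (F.W₁ * E) := by
  rw [Matrix.mul_sub, Matrix.mul_smul, F.W₁_mul_A, Matrix.sub_mul, Matrix.smul_mul, Matrix.one_mul]

theorem pencil_mul_T₁ (z : K) : (z • E - A) * F.T₁ = E * F.T₁ * (z • 1 - F.J) := by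
  rw [Matrix.sub_mul, Matrix.smul_mul, F.A_mul_T₁, Matrix.mul_sub, Matrix.mul_smul, Matrix.mul_one]

theorem pencil_mul_T₂ (z : K) : (z • E - A) * F.T₂ = -(A * F.T₂ * (1 - z • F.N)) := by
  rw [Matrix.sub_mul, Matrix.smul_mul, F.E_mul_T₂, Matrix.mul_sub, Matrix.mul_smul, Matrix.mul_one,
    neg_sub]

theorem isUnit_det_smul_one_sub_J {z : K} (h : IsUnit (z • E - A).det) :
    IsUnit (z • 1 - F.J).det := by
  rw [← Matrix.isUnit_iff_isUnit_det]
  refine IsUnit.of_mul_eq_one (F.W₁ * E * (z • E - A)⁻¹ * (E * F.T₁)) ?_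
  rw [← Matrix.mul_assoc, ← Matrix.mul_assoc (z • 1 - F.J), ← F.W₁_mul_pencil,
    mul_nonsing_inv_cancel_right _ _ h, ← Matrix.mul_assoc, F.W₁_mul_E_mul_T₁]

theorem pencil_mul_eq_one {z : K} {l : ℕ} (hl : F.N ^ l = 0) (h : IsUnit (z • 1 - F.J).det) :
    (z • E - A) * (F.T₁ * (z • 1 - F.J)⁻¹ * F.W₁
      - F.T₂ * (∑ k ∈ Finset.range l, (z • F.N) ^ k) * F.W₂) = 1 := by
  have hgeom : (1 - z • F.N) * ∑ k ∈ Finset.range l, (z • F.N) ^ k = 1 := by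
    rw [mul_neg_geom_sum, _root_.smul_pow, hl, smul_zero, sub_zero]
  have h₁ : (z • E - A) * (F.T₁ * (z • 1 - F.J)⁻¹ * F.W₁) = E * F.T₁ * F.W₁ := by
    rw [← Matrix.mul_assoc, ← Matrix.mul_assoc, pencil_mul_T₁, mul_nonsing_inv_cancel_right _ _ h]
  have h₂ : (z • E - A) * (F.T₂ * (∑ k ∈ Finset.range l, (z • F.N) ^ k) * F.W₂)
      = -(A * F.T₂ * F.W₂) := by
    rw [← Matrix.mul_assoc, ← Matrix.mul_assoc, pencil_mul_T₂, Matrix.neg_mul,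
      Matrix.mul_assoc (A * F.T₂), hgeom, Matrix.mul_one, Matrix.neg_mul]
  rw [Matrix.mul_sub, h₁, h₂, sub_neg_eq_add, E_mul_T₁_mul_W₁_add]

theorem inv_pencil {z : K} {l : ℕ} (hl : F.N ^ l = 0) (h : IsUnit (z • 1 - F.J).det) :
    (z • E - A)⁻¹ = F.T₁ * (z • 1 - F.J)⁻¹ * F.W₁
      - F.T₂ * (∑ k ∈ Finset.range l, (z • F.N) ^ k) * F.W₂ :=
  Matrix.inv_eq_right_inv (F.pencil_mul_eq_one hl h)

theorem isUnit_det_pencil {z : K} (h : IsUnit (z • 1 - F.J).det) : IsUnit (z • E - A).det := by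
  obtain ⟨l, hl⟩ := F.isNilpotent_N
  rw [← Matrix.isUnit_iff_isUnit_det]
  exact IsUnit.of_mul_eq_one _ (F.pencil_mul_eq_one hl h)

end Blocks

end WeierstrassForm

section ProperRationalFunctions

variable {K L Γ : Type*} [Field K] [Field L] [Algebra K L] [LinearOrderedCommGroupWithZero Γ]
  {ν μ κ : Type*} [Fintype ν]

theorem valuation_algebraMap_le_one (v : Valuation L Γ) [v.IsTrivialOn K] (a : K) :
    v (algebraMap K L a) ≤ 1 := by
  rcases eq_or_ne a 0 with rfl | ha
  · simp
  · exact (Valuation.IsTrivialOn.eq_one a ha).le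

theorem valuation_mul_le_of_smul_eq (v : Valuation L Γ) [v.IsTrivialOn K] {A : Matrix ν ν K}
    {z : L} (hz : 1 < v z) {g : Γ} {w b : ν → L} (hb : ∀ i, v (b i) ≤ g)
    (h : z • w = A.map (algebraMap K L) *ᵥ w + b) (i : ν) : v z * v (w i) ≤ g := by
  obtain ⟨i₀, -, hmax⟩ := Finset.exists_max_image Finset.univ (fun i => v (w i))
    ⟨i, Finset.mem_univ i⟩
  have hA : v ((A.map (algebraMap K L) *ᵥ w) i₀) ≤ v (w i₀) :=
    v.map_sum_le fun j _ => by
      simpa using mul_le_mul' (valuation_algebraMap_le_one v (A i₀ j)) (hmax j (Finset.mem_univ j))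
  have hi₀ : v z * v (w i₀) ≤ max (v (w i₀)) g := by
    have h₀ : z * w i₀ = (A.map (algebraMap K L) *ᵥ w) i₀ + b i₀ := congrFun h i₀
    rw [← map_mul, h₀]
    exact (v.map_add _ _).trans (max_le_max hA (hb i₀))
  refine (mul_le_mul_right (hmax i (Finset.mem_univ i)) _).trans ?_
  rcases le_max_iff.mp hi₀ with hle | hle
  · have hzero : v (w i₀) = 0 := by
      by_contra hne
      exact hle.not_gt (lt_mul_of_one_lt_left (zero_lt_iff.mpr hne) hz)
    simp [hzero]
  · exact hle

variable [DecidableEq ν]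

theorem isUnit_det_smul_one_sub_map (v : Valuation L Γ) [v.IsTrivialOn K] (A : Matrix ν ν K) {z : L}
    (hz : 1 < v z) : IsUnit (z • 1 - A.map (algebraMap K L)).det := by
  rw [isUnit_iff_ne_zero]
  intro hdet
  obtain ⟨w, hw, hker⟩ := exists_mulVec_eq_zero_iff.mpr hdet
  rw [sub_mulVec, smul_mulVec, one_mulVec, sub_eq_zero] at hker
  refine hw (funext fun i => ?_)
  have hle : v z * v (w i) ≤ 0 :=
    valuation_mul_le_of_smul_eq v hz (b := 0) (by simp) (by rw [hker, add_zero]) i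
  have hz₀ : v z ≠ 0 := (zero_lt_one.trans hz).ne'
  simpa [hz₀] using hle

theorem valuation_properTransfer_lt_one (v : Valuation L Γ) [v.IsTrivialOn K] (A : Matrix ν ν K)
    (B : Matrix ν μ K) (C : Matrix κ ν K) {z : L} (hz : 1 < v z) (i : κ) (j : μ) :
    v (properTransfer (A.map (algebraMap K L)) (B.map (algebraMap K L)) (C.map (algebraMap K L)) 0
      z i j) < 1 := by
  set R := (z • 1 - A.map (algebraMap K L))⁻¹ * B.map (algebraMap K L) with hR
  have hlt (k : ν) : v (R k j) < 1 := by
    have hsmul : (z • 1 - A.map (algebraMap K L)) * R = B.map (algebraMap K L) :=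
      mul_nonsing_inv_cancel_left _ _ (isUnit_det_smul_one_sub_map v A hz)
    rw [Matrix.sub_mul, Matrix.smul_mul, Matrix.one_mul, sub_eq_iff_eq_add'] at hsmul
    have hle : v z * v (R k j) ≤ 1 :=
      valuation_mul_le_of_smul_eq v hz (fun i => valuation_algebraMap_le_one v (B i j))
        (congrArg (fun M => M.col j) hsmul) k
    by_contra! hge
    exact hle.not_gt (hz.trans_le (le_mul_of_one_le_right' hge))
  rw [properTransfer, zero_add, Matrix.mul_assoc, ← hR, Matrix.mul_apply]
  refine v.map_sum_lt one_ne_zero fun k _ => ?_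
  rw [map_mul, Matrix.map_apply]
  exact (mul_le_of_le_one_left' (valuation_algebraMap_le_one v _)).trans_lt (hlt k)

open Classical in
theorem inftyValuation_lt_one_of_degree_lt {f : RatFunc K} (h : f.num.degree < f.denom.degree) :
    RatFunc.inftyValuation K f < 1 := by
  rcases eq_or_ne f 0 with rfl | hf
  · simp
  · have hnat := natDegree_lt_natDegree (RatFunc.num_ne_zero hf) h
    rw [RatFunc.inftyValuation_apply, RatFunc.inftyValuation_of_nonzero K hf, ← WithZero.exp_zero,
      WithZero.exp_lt_exp, RatFunc.intDegree]
    omega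

open Classical in
theorem eq_zero_of_inftyValuation_lt_one {q : K[X]}
    (h : RatFunc.inftyValuation K (algebraMap K[X] (RatFunc K) q) < 1) : q = 0 := by
  by_contra hq
  rw [RatFunc.inftyValuation_apply, RatFunc.inftyValuation.polynomial K hq, ← WithZero.exp_zero,
    WithZero.exp_lt_exp] at h
  omega

end ProperRationalFunctions

namespace DescriptorSystem

section PolynomialPart

variable {n m p : ℕ} (S : DescriptorSystem n m p)

open Classical in
theorem polynomialPart_eq_of_inftyValuation_lt_one {Q : Matrix (Fin p) (Fin m) ℝ[X]}
    (h : ∀ i j, RatFunc.inftyValuation ℝ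
      ((S.transfer (RatFunc.X : RatFunc ℝ) - Q.map (algebraMap ℝ[X] (RatFunc ℝ))) i j) < 1) :
    S.polynomialPart = Q := by
  ext1 i j
  rw [← sub_eq_zero]
  refine eq_zero_of_inftyValuation_lt_one ?_
  have hsub : algebraMap ℝ[X] (RatFunc ℝ) (S.polynomialPart i j - Q i j)
      = (S.transfer (RatFunc.X : RatFunc ℝ) - Q.map (algebraMap ℝ[X] (RatFunc ℝ))) i j
        - S.strictlyProperPart i j := by
    simp [strictlyProperPart]
  rw [hsub]
  exact (RatFunc.inftyValuation ℝ).map_sub_lt (h i j)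
    (inftyValuation_lt_one_of_degree_lt (S.strictlyProperPart_degree_lt i j))

variable (F : WeierstrassForm S.E S.A)

/-- The coefficient of `s ^ k` in the polynomial part of the transfer function, read off from a
Weierstrass form. -/
noncomputable def weierstrassCoeff (k : ℕ) : Matrix (Fin p) (Fin m) ℝ :=
  (if k = 0 then S.D else 0) - S.C * F.T₂ * F.N ^ k * F.W₂ * S.B

variable {S} in
theorem weierstrassCoeff_eq_zero {l k : ℕ} (hl : F.N ^ (l + 1) = 0) (hk : l < k) :
    S.weierstrassCoeff F k = 0 := by
  rw [weierstrassCoeff, if_neg (by omega), pow_eq_zero_of_le hk hl, Matrix.mul_zero,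
    Matrix.zero_mul, Matrix.zero_mul, sub_zero]

theorem sum_smul_weierstrassCoeff {K : Type*} [Field K] [Algebra ℝ K] (z : K) (l : ℕ) :
    ∑ k ∈ Finset.range (l + 1), z ^ k • (S.weierstrassCoeff F k).map (algebraMap ℝ K)
      = S.D.map (algebraMap ℝ K) - S.C.map (algebraMap ℝ K) * (F.T₂.map (algebraMap ℝ K)
        * (∑ k ∈ Finset.range (l + 1), (z • F.N.map (algebraMap ℝ K)) ^ k)
          * F.W₂.map (algebraMap ℝ K)) * S.B.map (algebraMap ℝ K) := by
  have hterm (k : ℕ) : z ^ k • (S.weierstrassCoeff F k).map (algebraMap ℝ K)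
      = (if k = 0 then S.D.map (algebraMap ℝ K) else 0)
        - S.C.map (algebraMap ℝ K) * (F.T₂.map (algebraMap ℝ K)
          * (z • F.N.map (algebraMap ℝ K)) ^ k * F.W₂.map (algebraMap ℝ K))
          * S.B.map (algebraMap ℝ K) := by
    rw [weierstrassCoeff, Matrix.map_sub _ (map_sub _), smul_sub, _root_.smul_pow]
    simp only [Matrix.map_mul, Matrix.map_pow, Matrix.mul_smul, Matrix.smul_mul, Matrix.mul_assoc]
    congr 1
    split_ifs with hk
    · rw [hk, pow_zero, one_smul]
    · simp
  simp only [hterm, Finset.sum_sub_distrib, Finset.sum_ite_eq', Finset.mem_range, Nat.zero_lt_succ,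
    if_true, Matrix.mul_sum, Matrix.sum_mul]

theorem transfer_eq_add_sum {K : Type*} [Field K] [Algebra ℝ K] {z : K} {l : ℕ}
    (hl : F.N ^ (l + 1) = 0) (h : IsUnit (z • 1 - F.J.map (algebraMap ℝ K)).det) :
    S.transfer z = properTransfer (F.J.map (algebraMap ℝ K)) ((F.W₁ * S.B).map (algebraMap ℝ K))
        ((S.C * F.T₁).map (algebraMap ℝ K)) 0 z
      + ∑ k ∈ Finset.range (l + 1), z ^ k • (S.weierstrassCoeff F k).map (algebraMap ℝ K) := by
  have hl' : (F.N.map (algebraMap ℝ K)) ^ (l + 1) = 0 := by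
    rw [← Matrix.map_pow, hl, Matrix.map_zero _ (map_zero _)]
  have hinv : (matrixPencil S.E S.A z)⁻¹
      = F.T₁.map (algebraMap ℝ K) * (z • 1 - F.J.map (algebraMap ℝ K))⁻¹
          * F.W₁.map (algebraMap ℝ K)
        - F.T₂.map (algebraMap ℝ K) * (∑ k ∈ Finset.range (l + 1),
          (z • F.N.map (algebraMap ℝ K)) ^ k) * F.W₂.map (algebraMap ℝ K) :=
    (F.map (algebraMap ℝ K)).inv_pencil hl' h
  rw [sum_smul_weierstrassCoeff, transfer, hinv, properTransfer]
  simp only [Matrix.map_mul, Matrix.mul_sub, Matrix.sub_mul, Matrix.mul_assoc]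
  abel

theorem polynomialPart_eq {l : ℕ} (hl : F.N ^ (l + 1) = 0) : S.polynomialPart
    = ∑ k ∈ Finset.range (l + 1), (X : ℝ[X]) ^ k • (S.weierstrassCoeff F k).map Polynomial.C := by
  classical
  have hX : 1 < RatFunc.inftyValuation ℝ RatFunc.X := by
    rw [RatFunc.inftyValuation.X, ← WithZero.exp_zero, WithZero.exp_lt_exp]
    exact one_pos
  refine S.polynomialPart_eq_of_inftyValuation_lt_one fun i j => ?_
  have hmap : (∑ k ∈ Finset.range (l + 1),
        (X : ℝ[X]) ^ k • (S.weierstrassCoeff F k).map Polynomial.C).map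
          (algebraMap ℝ[X] (RatFunc ℝ))
      = ∑ k ∈ Finset.range (l + 1),
        (RatFunc.X : RatFunc ℝ) ^ k • (S.weierstrassCoeff F k).map (algebraMap ℝ (RatFunc ℝ)) := by
    ext i j
    simp only [Matrix.map_apply, Matrix.sum_apply, Matrix.smul_apply, smul_eq_mul, map_sum, map_mul,
      map_pow, RatFunc.algebraMap_X, RatFunc.algebraMap_C, RatFunc.algebraMap_eq_C]
  rw [hmap, S.transfer_eq_add_sum F hl (isUnit_det_smul_one_sub_map _ _ hX), add_sub_cancel_right]
  exact valuation_properTransfer_lt_one _ _ _ _ hX i j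

theorem polynomialCoeff_eq_weierstrassCoeff (k : ℕ) :
    S.polynomialCoeff k = S.weierstrassCoeff F k := by
  obtain ⟨l, hl⟩ := F.isNilpotent_N
  have hl' : F.N ^ (l + 1) = 0 := by rw [pow_succ, hl, zero_mul]
  ext i j
  have hcoeff : S.polynomialCoeff k i j
      = ∑ d ∈ Finset.range (l + 1), if k = d then S.weierstrassCoeff F d i j else 0 := by
    simp [polynomialCoeff, S.polynomialPart_eq F hl', Matrix.sum_apply]
  rw [hcoeff, Finset.sum_ite_eq]
  split_ifs with hk
  · rfl
  · rw [weierstrassCoeff_eq_zero F hl' (by simpa using hk)]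
    rfl

end PolynomialPart

end DescriptorSystem

section PolynomialGrowth

open Filter Topology Bornology

theorem tendsto_inv_pow_smul_add_sum {𝕜 V : Type*} [NontriviallyNormedField 𝕜] [AddCommGroup V]
    [Module 𝕜 V] [TopologicalSpace V] [ContinuousAdd V] [ContinuousSMul 𝕜 V] {f : 𝕜 → V}
    (hf : Tendsto f (cobounded 𝕜) (𝓝 0)) (M : ℕ → V) (l : ℕ) :
    Tendsto (fun s => (s ^ l)⁻¹ • (f s + ∑ k ∈ Finset.range (l + 1), s ^ k • M k))
      (cobounded 𝕜) (𝓝 (M l)) := by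
  induction l generalizing f M with
  | zero => simpa using hf.add_const (M 0)
  | succ l ih =>
    have hf' : Tendsto (fun s => s⁻¹ • (f s + M 0)) (cobounded 𝕜) (𝓝 0) := by
      simpa using (tendsto_inv₀_cobounded (α := 𝕜)).smul (hf.add_const (M 0))
    refine (ih hf' fun k => M (k + 1)).congr' ?_
    filter_upwards [eventually_ne_cobounded 0] with s hs
    have hterm (k : ℕ) : s ^ (k + 1) • M (k + 1) = s • s ^ k • M (k + 1) := by
      rw [smul_smul, pow_succ']
    rw [Finset.sum_range_succ' _ (l + 1), pow_zero, one_smul, pow_succ, mul_inv, mul_smul]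
    simp only [hterm, ← Finset.smul_sum, smul_add, inv_smul_smul₀ hs]
    abel

variable {𝕜 μ κ : Type*} [NontriviallyNormedField 𝕜] [Fintype μ]

theorem mul_transpose_eq_zero_of_eventually {f : 𝕜 → Matrix κ μ 𝕜} {Q : Matrix κ κ 𝕜}
    (hf : Tendsto f (cobounded 𝕜) (𝓝 0)) (M : ℕ → Matrix κ μ 𝕜) {l : ℕ} (hl : l ≠ 0)
    (h : ∀ᶠ s in cobounded 𝕜, (f s + ∑ k ∈ Finset.range (l + 1), s ^ k • M k)
      * (f (-s) + ∑ k ∈ Finset.range (l + 1), (-s) ^ k • M k)ᵀ = Q) :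
    M l * (M l)ᵀ = 0 := by
  have hlim := tendsto_inv_pow_smul_add_sum hf M l
  have hneg := tendsto_neg_cobounded (E := 𝕜)
  have hcont : Continuous fun N : Matrix κ μ 𝕜 × Matrix κ μ 𝕜 => N.1 * N.2ᵀ := by fun_prop
  have hmul := (hcont.tendsto (M l, M l)).comp (hlim.prodMk_nhds (hlim.comp hneg))
  have hpow : Tendsto (fun s : 𝕜 => (s ^ l)⁻¹) (cobounded 𝕜) (𝓝 0) := by
    simpa [hl] using (tendsto_inv₀_cobounded (α := 𝕜)).pow l
  have hzero : Tendsto (fun s : 𝕜 => ((-s) ^ l)⁻¹ • (s ^ l)⁻¹ • Q) (cobounded 𝕜) (𝓝 0) := by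
    simpa using (hpow.comp hneg).smul (hpow.smul_const Q)
  refine tendsto_nhds_unique_of_eventuallyEq hmul hzero ?_
  filter_upwards [h] with s hs
  simp only [Function.comp_apply, Matrix.transpose_smul, Matrix.smul_mul, Matrix.mul_smul, hs]

theorem eq_zero_of_eventually_mul_transpose_eq {Q : Matrix κ κ ℝ} {f : ℝ → Matrix κ μ ℝ}
    (hf : Tendsto f (cobounded ℝ) (𝓝 0)) {M : ℕ → Matrix κ μ ℝ} {l : ℕ}
    (h : ∀ᶠ s in cobounded ℝ, (f s + ∑ k ∈ Finset.range (l + 1), s ^ k • M k)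
      * (f (-s) + ∑ k ∈ Finset.range (l + 1), (-s) ^ k • M k)ᵀ = Q) {k : ℕ} (hk : k ≠ 0)
    (hkl : k ≤ l) : M k = 0 := by
  induction l with
  | zero => omega
  | succ l ih =>
    have hlead : M (l + 1) = 0 := Matrix.self_mul_conjTranspose_eq_zero.mp
      (mul_transpose_eq_zero_of_eventually hf M l.succ_ne_zero h)
    rcases hkl.eq_or_lt with rfl | hlt
    · exact hlead
    · simp only [Finset.sum_range_succ _ (l + 1), hlead, smul_zero, add_zero] at h
      exact ih h (Nat.lt_succ_iff.mp hlt)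

end PolynomialGrowth

theorem eq_zero_of_mulVec_eq_zero_of_rank {K μ ν : Type*} [Field K] [Finite μ] [Fintype ν]
    {M : Matrix μ ν K} (hM : M.rank = Fintype.card ν) {v : ν → K} (hv : M *ᵥ v = 0) : v = 0 := by
  have hker := M.mulVecLin.finrank_range_add_finrank_ker
  rw [← Matrix.rank, hM, Module.finrank_fintype_fun_eq_card, Nat.add_eq_left,
    Submodule.finrank_eq_zero] at hker
  exact (Submodule.eq_bot_iff _).mp hker v hv

namespace WeierstrassForm

section Rank

variable {K μ κ : Type*} [Field K] [IsAlgClosed K] {n : ℕ} {E A : Matrix (Fin n) (Fin n) K}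
  (F : WeierstrassForm E A)

theorem isObservablePair [Finite κ] {C : Matrix κ (Fin n) K}
    (h : ∀ z : K, (fromRows (z • E - A) C).rank = n) : IsObservablePair F.J (C * F.T₁) := by
  refine IsObservablePair.of_eigenvectors fun z v hJ hC => ?_
  have hpencil : (z • E - A) *ᵥ F.T₁ *ᵥ v = 0 := by
    rw [Matrix.mulVec_mulVec, F.pencil_mul_T₁, ← Matrix.mulVec_mulVec, Matrix.sub_mulVec,
      Matrix.smul_mulVec, Matrix.one_mulVec, hJ, sub_self, Matrix.mulVec_zero]
  have hT : F.T₁ *ᵥ v = 0 := by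
    refine eq_zero_of_mulVec_eq_zero_of_rank ((h z).trans (Fintype.card_fin n).symm) ?_
    rw [fromRows_mulVec, hpencil, Matrix.mulVec_mulVec, hC]
    exact Sum.elim_zero_zero
  rw [← Matrix.one_mulVec v, ← F.W₁_mul_E_mul_T₁, ← Matrix.mulVec_mulVec, hT, Matrix.mulVec_zero]

theorem isControllablePair [Fintype μ] {B : Matrix (Fin n) μ K}
    (h : ∀ z : K, (fromCols (z • E - A) B).rank = n) : IsControllablePair F.J (F.W₁ * B) := by
  have hobs : IsObservablePair F.Jᵀ (Bᵀ * F.W₁ᵀ) := F.transpose.isObservablePair fun z => by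
    rw [← Matrix.transpose_smul, ← Matrix.transpose_sub, ← transpose_fromCols,
      Matrix.rank_transpose, h z]
  rwa [← Matrix.transpose_mul] at hobs

end Rank

section ProjectedGramian

variable {K : Type*} [Field K] {n : ℕ} {E A : Matrix (Fin n) (Fin n) K} {μ κ : Type*}

/-- A solution of the projected generalized Lyapunov equation of a descriptor system that satisfies
the coupling constraint with the constant coefficient `D` of the polynomial part. It is the
counterpart of `IsAllPassGramian` in the coordinates of the descriptor system. -/
structure IsProjectedGramian [Fintype μ] (F : WeierstrassForm E A) (B : Matrix (Fin n) μ K)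
    (C : Matrix κ (Fin n) K) (D : Matrix κ μ K) (G : Matrix (Fin n) (Fin n) K) : Prop where
  isSymm : G.IsSymm
  eq_right_mul_mul : G = F.right * G * F.rightᵀ
  lyapunov : E * G * Aᵀ + A * G * Eᵀ + F.left * B * Bᵀ * F.leftᵀ = 0
  coupling : D * Bᵀ * F.leftᵀ + C * G * Eᵀ = 0

variable (F : WeierstrassForm E A) {B : Matrix (Fin n) μ K} {C : Matrix κ (Fin n) K}
  {D : Matrix κ μ K}

theorem right_mul_T₁ : F.right * F.T₁ = F.T₁ := by
  rw [right_eq, Matrix.mul_assoc, Matrix.mul_assoc, ← Matrix.mul_assoc F.W₁, W₁_mul_E_mul_T₁,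
    Matrix.mul_one]

theorem right_mul_right : F.right * F.right = F.right := by
  nth_rw 2 [right_eq]
  rw [← Matrix.mul_assoc, ← Matrix.mul_assoc, right_mul_T₁, ← right_eq]

theorem W₁_mul_left : F.W₁ * F.left = F.W₁ := by
  rw [left_eq, ← Matrix.mul_assoc, ← Matrix.mul_assoc, W₁_mul_E_mul_T₁, Matrix.one_mul]

theorem isProjectedGramian [Fintype μ] [DecidableEq κ] {c : K} {X : Matrix (Fin F.nf) (Fin F.nf) K}
    (h : IsAllPassGramian F.J (F.W₁ * B) (C * F.T₁) D c X) :
    F.IsProjectedGramian B C D (F.T₁ * X * F.T₁ᵀ) where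
  isSymm := by simp [Matrix.IsSymm, Matrix.mul_assoc, h.isSymm.eq]
  eq_right_mul_mul := by
    have hT : F.T₁ᵀ * F.rightᵀ = F.T₁ᵀ := by rw [← Matrix.transpose_mul, right_mul_T₁]
    rw [← Matrix.mul_assoc, ← Matrix.mul_assoc, right_mul_T₁, Matrix.mul_assoc _ _ F.rightᵀ, hT]
  lyapunov := by
    calc E * (F.T₁ * X * F.T₁ᵀ) * Aᵀ + A * (F.T₁ * X * F.T₁ᵀ) * Eᵀ + F.left * B * Bᵀ * F.leftᵀ
        = E * F.T₁ * X * (A * F.T₁)ᵀ + A * F.T₁ * X * (E * F.T₁)ᵀ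
            + F.left * B * Bᵀ * F.leftᵀ := by
          simp only [Matrix.transpose_mul, Matrix.mul_assoc]
      _ = E * F.T₁ * (X * F.Jᵀ + F.J * X + F.W₁ * B * (F.W₁ * B)ᵀ) * (E * F.T₁)ᵀ := by
          rw [A_mul_T₁, left_eq]
          simp only [Matrix.transpose_mul, Matrix.mul_add, Matrix.add_mul, Matrix.mul_assoc]
      _ = 0 := by rw [h.lyapunov, Matrix.mul_zero, Matrix.zero_mul]
  coupling := by
    calc D * Bᵀ * F.leftᵀ + C * (F.T₁ * X * F.T₁ᵀ) * Eᵀ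
        = (D * (F.W₁ * B)ᵀ + C * F.T₁ * X) * (E * F.T₁)ᵀ := by
          rw [left_eq]
          simp only [Matrix.transpose_mul, Matrix.add_mul, Matrix.mul_assoc]
      _ = 0 := by rw [h.coupling, Matrix.zero_mul]

theorem isProjectedGramian_transpose [Fintype κ] [DecidableEq μ] {c : K}
    {Y : Matrix (Fin F.nf) (Fin F.nf) K}
    (h : IsAllPassGramian F.Jᵀ (C * F.T₁)ᵀ (F.W₁ * B)ᵀ Dᵀ c Y) :
    F.transpose.IsProjectedGramian Cᵀ Bᵀ Dᵀ (F.W₁ᵀ * Y * F.W₁) := by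
  rw [Matrix.transpose_mul, Matrix.transpose_mul] at h
  exact F.transpose.isProjectedGramian h

theorem gramian_mul_gramian_eq_smul_right {c : K} {X Y : Matrix (Fin F.nf) (Fin F.nf) K}
    (hXY : X * Y = c • 1) :
    F.T₁ * X * F.T₁ᵀ * Eᵀ * (F.W₁ᵀ * Y * F.W₁) * E = c • F.right := by
  have hone : F.T₁ᵀ * Eᵀ * F.W₁ᵀ = 1 := by
    rw [← Matrix.transpose_mul, ← Matrix.transpose_mul, ← Matrix.mul_assoc, W₁_mul_E_mul_T₁,
      Matrix.transpose_one]
  calc F.T₁ * X * F.T₁ᵀ * Eᵀ * (F.W₁ᵀ * Y * F.W₁) * E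
      = F.T₁ * X * (F.T₁ᵀ * Eᵀ * F.W₁ᵀ) * Y * F.W₁ * E := by simp only [Matrix.mul_assoc]
    _ = F.T₁ * (X * Y) * F.W₁ * E := by rw [hone, Matrix.mul_one, Matrix.mul_assoc F.T₁]
    _ = c • F.right := by
      rw [hXY, Matrix.mul_smul, Matrix.mul_one, Matrix.smul_mul, Matrix.smul_mul, right_eq]

variable {F}

theorem IsProjectedGramian.isAllPassGramian [Fintype μ] [DecidableEq κ] {c : K}
    {G : Matrix (Fin n) (Fin n) K} (h : F.IsProjectedGramian B C D G) (hD : D * Dᵀ = c • 1) :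
    IsAllPassGramian F.J (F.W₁ * B) (C * F.T₁) D c (F.W₁ * E * G * (F.W₁ * E)ᵀ) where
  isSymm := by simp [Matrix.IsSymm, Matrix.mul_assoc, h.isSymm.eq]
  lyapunov := by
    calc F.W₁ * E * G * (F.W₁ * E)ᵀ * F.Jᵀ + F.J * (F.W₁ * E * G * (F.W₁ * E)ᵀ)
          + F.W₁ * B * (F.W₁ * B)ᵀ
        = F.W₁ * E * G * (F.J * (F.W₁ * E))ᵀ + F.J * (F.W₁ * E) * G * (F.W₁ * E)ᵀ
            + F.W₁ * F.left * B * (F.W₁ * F.left * B)ᵀ := by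
          rw [W₁_mul_left]
          simp only [Matrix.transpose_mul, Matrix.mul_assoc]
      _ = F.W₁ * (E * G * Aᵀ + A * G * Eᵀ + F.left * B * Bᵀ * F.leftᵀ) * F.W₁ᵀ := by
          rw [← W₁_mul_A]
          simp only [Matrix.transpose_mul, Matrix.mul_add, Matrix.add_mul, Matrix.mul_assoc]
      _ = 0 := by rw [h.lyapunov, Matrix.mul_zero, Matrix.zero_mul]
  feedthrough := hD
  coupling := by
    have hG : F.right * G = G := by
      rw [h.eq_right_mul_mul, ← Matrix.mul_assoc, ← Matrix.mul_assoc, right_mul_right]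
    have hW : F.leftᵀ * F.W₁ᵀ = F.W₁ᵀ := by rw [← Matrix.transpose_mul, W₁_mul_left]
    calc D * (F.W₁ * B)ᵀ + C * F.T₁ * (F.W₁ * E * G * (F.W₁ * E)ᵀ)
        = D * Bᵀ * (F.leftᵀ * F.W₁ᵀ) + C * (F.T₁ * F.W₁ * E * G) * Eᵀ * F.W₁ᵀ := by
          rw [hW]
          simp only [Matrix.transpose_mul, Matrix.mul_assoc]
      _ = (D * Bᵀ * F.leftᵀ + C * G * Eᵀ) * F.W₁ᵀ := by
          rw [← right_eq, hG, Matrix.add_mul, Matrix.mul_assoc (D * Bᵀ)]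
      _ = 0 := by rw [h.coupling, Matrix.zero_mul]

end ProjectedGramian

end WeierstrassForm

namespace DescriptorSystem

section FiniteSpectrum

variable {n m p : ℕ} {S : DescriptorSystem n m p}

theorem RObservable.isObservablePair (h : S.RObservable) (F : WeierstrassForm S.E S.A) :
    IsObservablePair F.J (S.C * F.T₁) := by
  refine .of_map (algebraMap ℝ ℂ) ?_
  rw [Matrix.map_mul]
  exact (F.map (algebraMap ℝ ℂ)).isObservablePair h

theorem RControllable.isControllablePair (h : S.RControllable) (F : WeierstrassForm S.E S.A) :
    IsControllablePair F.J (F.W₁ * S.B) := by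
  refine .of_map (algebraMap ℝ ℂ) ?_
  rw [Matrix.transpose_map, Matrix.transpose_map, Matrix.map_mul]
  exact (F.map (algebraMap ℝ ℂ)).isControllablePair h

theorem transfer_eq_properTransfer (F : WeierstrassForm S.E S.A)
    (hM : ∀ k, 1 ≤ k → S.polynomialCoeff k = 0) {K : Type*} [Field K] [Algebra ℝ K] {z : K}
    (hz : IsUnit (z • 1 - F.J.map (algebraMap ℝ K)).det) :
    S.transfer z = properTransfer (F.J.map (algebraMap ℝ K)) ((F.W₁ * S.B).map (algebraMap ℝ K))
      ((S.C * F.T₁).map (algebraMap ℝ K)) ((S.polynomialCoeff 0).map (algebraMap ℝ K)) z := by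
  obtain ⟨l, hl⟩ := F.isNilpotent_N
  have hsum : ∑ k ∈ Finset.range (l + 1), z ^ k • (S.weierstrassCoeff F k).map (algebraMap ℝ K)
      = (S.polynomialCoeff 0).map (algebraMap ℝ K) := by
    rw [Finset.sum_range_succ', Finset.sum_eq_zero, zero_add, pow_zero, one_smul,
      polynomialCoeff_eq_weierstrassCoeff S F]
    intro k _
    rw [← polynomialCoeff_eq_weierstrassCoeff, hM (k + 1) k.succ_pos,
      Matrix.map_zero _ (map_zero _), smul_zero]
  rw [S.transfer_eq_add_sum F (pow_eq_zero_of_le l.le_succ hl) hz, hsum, properTransfer,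
    properTransfer, zero_add, add_comm]

theorem matrixPencil_algebraMap {E A : Matrix (Fin n) (Fin n) ℝ} {K : Type*} [Field K] [Algebra ℝ K]
    (s : ℝ) : matrixPencil E A (algebraMap ℝ K s) = (matrixPencil E A s).map (algebraMap ℝ K) := by
  ext i j
  simp only [matrixPencil, Matrix.sub_apply, Matrix.smul_apply, Matrix.map_apply, smul_eq_mul,
    map_sub, map_mul, Algebra.algebraMap_self, RingHom.id_apply]

variable (S) in
theorem transfer_algebraMap {K : Type*} [Field K] [Algebra ℝ K] (s : ℝ) :
    S.transfer (algebraMap ℝ K s) = (S.transfer s).map (algebraMap ℝ K) := by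
  rw [transfer, matrixPencil_algebraMap, ← map_nonsing_inv, transfer]
  simp [Matrix.map_add, Matrix.map_mul]

theorem transfer_real_eq_add_sum (F : WeierstrassForm S.E S.A) {l : ℕ}
    (hl : F.N ^ (l + 1) = 0) {s : ℝ} (hs : IsUnit (s • 1 - F.J).det) :
    S.transfer s = properTransfer F.J (F.W₁ * S.B) (S.C * F.T₁) 0 s
      + ∑ k ∈ Finset.range (l + 1), s ^ k • S.polynomialCoeff k := by
  simpa [polynomialCoeff_eq_weierstrassCoeff S F] using
    S.transfer_eq_add_sum F hl (z := s) (by simpa using hs)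

end FiniteSpectrum

open Filter Bornology

variable {n m : ℕ} {S : DescriptorSystem n m m} {ς : ℝ}

namespace IsAllPass

theorem transfer_mul_transpose_real (h : S.IsAllPass ς) {s : ℝ}
    (hs : IsUnit (s • S.E - S.A).det) (hs' : IsUnit ((-s) • S.E - S.A).det) :
    S.transfer s * (S.transfer (-s))ᵀ = ς ^ 2 • 1 := by
  have hdet {t : ℝ} (ht : IsUnit (t • S.E - S.A).det) :
      (matrixPencil S.E S.A (algebraMap ℝ ℂ t)).det ≠ 0 := by
    rw [matrixPencil_algebraMap, ← RingHom.mapMatrix_apply, ← RingHom.map_det]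
    exact (ht.map (algebraMap ℝ ℂ)).ne_zero
  have hℂ := h (algebraMap ℝ ℂ s) (hdet hs) (by simpa only [map_neg] using hdet hs')
  rw [← map_neg, transfer_algebraMap, transfer_algebraMap, ← Matrix.transpose_map,
    ← Matrix.map_mul] at hℂ
  refine Matrix.map_injective (algebraMap ℝ ℂ).injective (hℂ.trans ?_)
  simp [Matrix.map_smul']

theorem eventually_transfer_mul_transpose (h : S.IsAllPass ς) (F : WeierstrassForm S.E S.A) :
    ∀ᶠ s in cobounded ℝ, IsUnit (s • 1 - F.J).det ∧ IsUnit ((-s) • 1 - F.J).det ∧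
      S.transfer s * (S.transfer (-s))ᵀ = ς ^ 2 • 1 := by
  have hunit := eventually_isUnit_det_smul_one_sub F.J
  filter_upwards [hunit, (tendsto_neg_cobounded (E := ℝ)).eventually hunit] with s hs hs'
  exact ⟨hs, hs', h.transfer_mul_transpose_real (F.isUnit_det_pencil hs) (F.isUnit_det_pencil hs')⟩

theorem polynomialCoeff_eq_zero (h : S.IsAllPass ς) (F : WeierstrassForm S.E S.A) {k : ℕ}
    (hk : 1 ≤ k) : S.polynomialCoeff k = 0 := by
  obtain ⟨l, hl⟩ := F.isNilpotent_N
  have hl' : F.N ^ (l + k + 1) = 0 := pow_eq_zero_of_le (by omega) hl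
  refine eq_zero_of_eventually_mul_transpose_eq (Q := ς ^ 2 • 1)
    (tendsto_properTransfer F.J (F.W₁ * S.B) (S.C * F.T₁) 0) ?_ (Nat.one_le_iff_ne_zero.mp hk)
    (Nat.le_add_left k l)
  filter_upwards [h.eventually_transfer_mul_transpose F] with s ⟨hs, hs', heq⟩
  rw [← transfer_real_eq_add_sum F hl' hs, ← transfer_real_eq_add_sum F hl' hs', heq]

theorem exists_isAllPassGramian (h : S.IsAllPass ς) (F : WeierstrassForm S.E S.A) (hς : ς ≠ 0)
    (hctrl : S.RControllable) (hobs : S.RObservable) :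
    ∃ X, IsUnit X ∧
      IsAllPassGramian F.J (F.W₁ * S.B) (S.C * F.T₁) (S.polynomialCoeff 0) (ς ^ 2) X := by
  refine _root_.exists_isAllPassGramian (pow_ne_zero 2 hς) (hctrl.isControllablePair F)
    (hobs.isObservablePair F) ?_
  filter_upwards [h.eventually_transfer_mul_transpose F] with s ⟨hs, hs', heq⟩
  have hproper {t : ℝ} (ht : IsUnit (t • 1 - F.J).det) : S.transfer t
      = properTransfer F.J (F.W₁ * S.B) (S.C * F.T₁) (S.polynomialCoeff 0) t := by
    simpa using transfer_eq_properTransfer F (fun _ hk => h.polynomialCoeff_eq_zero F hk) (z := t)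
      (by simpa using ht)
  rw [← hproper hs, ← hproper hs', heq]

end IsAllPass

theorem isAllPass_of_isAllPassGramian (F : WeierstrassForm S.E S.A)
    {X : Matrix (Fin F.nf) (Fin F.nf) ℝ}
    (hX : IsAllPassGramian F.J (F.W₁ * S.B) (S.C * F.T₁) (S.polynomialCoeff 0) (ς ^ 2) X)
    (hM : ∀ k, 1 ≤ k → S.polynomialCoeff k = 0) : S.IsAllPass ς := by
  intro s hs hs'
  have hJ {z : ℂ} (hz : (matrixPencil S.E S.A z).det ≠ 0) :
      IsUnit (z • 1 - F.J.map (algebraMap ℝ ℂ)).det :=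
    (F.map (algebraMap ℝ ℂ)).isUnit_det_smul_one_sub_J (isUnit_iff_ne_zero.mpr hz)
  rw [transfer_eq_properTransfer F hM (hJ hs), transfer_eq_properTransfer F hM (hJ hs'),
    (hX.map (algebraMap ℝ ℂ)).properTransfer_mul_transpose (hJ hs) (hJ hs'), map_pow,
    Complex.coe_algebraMap]

end DescriptorSystem

theorem theorem1 {n m : ℕ} (S : DescriptorSystem n m m) (hreg : S.IsRegular)
    (hctrl : S.RControllable) (hobs : S.RObservable) (ς : ℝ) (hς : 0 < ς) :
    S.IsAllPass ς ↔
      ∃ Gpc Gpo : Matrix (Fin n) (Fin n) ℝ,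
        -- symmetric matrices, compatible with the spectral projectors
        (Gpc.IsSymm ∧ Gpo.IsSymm ∧
          Gpc = S.rightProjector hreg * Gpc * (S.rightProjector hreg)ᵀ ∧
          Gpo = (S.leftProjector hreg)ᵀ * Gpo * S.leftProjector hreg) ∧
        -- projected generalized continuous-time Lyapunov equations
        (S.E * Gpc * S.Aᵀ + S.A * Gpc * S.Eᵀ
            + S.leftProjector hreg * S.B * S.Bᵀ * (S.leftProjector hreg)ᵀ = 0 ∧
          S.Eᵀ * Gpo * S.A + S.Aᵀ * Gpo * S.E
            + (S.rightProjector hreg)ᵀ * S.Cᵀ * S.C * S.rightProjector hreg = 0) ∧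
        -- proper Hankel singular values
        (Gpc * S.Eᵀ * Gpo * S.E = ς ^ 2 • S.rightProjector hreg ∧
          Gpo * S.E * Gpc * S.Eᵀ = ς ^ 2 • (S.leftProjector hreg)ᵀ) ∧
        -- polynomial part of the transfer function
        (S.polynomialCoeff 0 * (S.polynomialCoeff 0)ᵀ = ς ^ 2 • (1 : Matrix (Fin m) (Fin m) ℝ) ∧
          ∀ k : ℕ, 1 ≤ k → S.polynomialCoeff k = 0) ∧
        -- coupling constraints
        ((S.polynomialCoeff 0)ᵀ * S.C * S.rightProjector hreg + S.Bᵀ * Gpo * S.E = 0 ∧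
          S.polynomialCoeff 0 * S.Bᵀ * (S.leftProjector hreg)ᵀ + S.C * Gpc * S.Eᵀ = 0) := by
  set F := Classical.choice hreg.exists_weierstrassForm
  have hl : S.leftProjector hreg = F.left := rfl
  have hr : S.rightProjector hreg = F.right := rfl
  rw [hl, hr]
  constructor
  · intro h
    have hc : ς ^ 2 ≠ 0 := pow_ne_zero 2 hς.ne'
    obtain ⟨X, hunit, hX⟩ := h.exists_isAllPassGramian F hς.ne' hctrl hobs
    have hXY : X * (ς ^ 2 • X⁻¹) = ς ^ 2 • 1 := by
      rw [Matrix.mul_smul, mul_nonsing_inv _ ((isUnit_iff_isUnit_det X).mp hunit)]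
    have hpc := F.isProjectedGramian hX
    have hpo := F.isProjectedGramian_transpose (hX.dual hc hXY)
    have hco := F.transpose.gramian_mul_gramian_eq_smul_right (mul_eq_smul_one_comm hc hXY)
    obtain ⟨hsymm, hproj, hlyap, hcoup⟩ := hpo
    simp only [F.transpose_left, F.transpose_right, transpose_transpose] at hproj hlyap hcoup hco
    exact ⟨_, _, ⟨hpc.isSymm, hsymm, hpc.eq_right_mul_mul, hproj⟩, ⟨hpc.lyapunov, hlyap⟩,
      ⟨F.gramian_mul_gramian_eq_smul_right hXY, hco⟩,
      ⟨hX.feedthrough, fun _ hk => h.polynomialCoeff_eq_zero F hk⟩, hcoup, hpc.coupling⟩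
  · rintro ⟨Gpc, Gpo, ⟨hsymm, -, hproj, -⟩, ⟨hlyap, -⟩, -, ⟨hM₀, hM⟩, -, hcoup⟩
    have hpc : F.IsProjectedGramian S.B S.C (S.polynomialCoeff 0) Gpc :=
      ⟨hsymm, hproj, hlyap, hcoup⟩
    exact DescriptorSystem.isAllPass_of_isAllPassGramian F (hpc.isAllPassGramian hM₀) hM
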